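/- Let $\mathcal K$ be a field, let $\Gamma\le\mathbb R$ be an additive subgroup, and let \[\Lambda=\Lambda^{\mathcal K,\Gamma}=\Big\{\sum_{g\in\Gamma}a_gT^g \;\Big|\; a_g\in\mathcal K,\ \#\{g : a_g\ne 0,\ g<C\}<\infty\text{ for all }C\in\mathbb R\Big\}\] be the Novikov field, with valuation $\nu(\sum a_gT^g)=\min\{g: a_g\neq 0\}$ and $\nu(0)=\infty$. A \emph{filtration function} on a finite-dimensional $\Lambda$-vector space $V$ is a map $\ell\colon V\to\mathbb R\cup\{-\infty\}$ such that $\ell(x)=-\infty$ iff $x=0$, $\ell(\lambda x)=\ell(x)-\nu(\lambda)$, and $\ell(x+y)\le\max\{\ell(x),\ell(y)\}$. A finite family $(w_i)$ in $V$ is \emph{orthogonal} if $\ell(\sum\lambda_iw_i)=\max_i\ell(\lambda_iw_i)$ for all $\lambda_i\in\Lambda$, and $(V,\ell)$ is \emph{orthogonalizable} if it has an orthogonal basis. A \emph{Floer-type complex} is a $\mathbb Z$-graded chain complex $(C_*,\partial)$ of $\Lambda$-vector spaces with functions $\ell\colon C_k\to\mathbb R\cup\{-\infty\}$, $k\in\mathbb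 Z$, such that each $(C_k,\ell)$ is orthogonalizable and $\ell(\partial x)\le\ell(x)$. A \emph{filtered chain isomorphism} is an isomorphism of chain complexes $\Phi$ with $\ell(\Phi(x))=\ell(x)$ for all $k$ and all $x\in C_k$. For $k\in\mathbb Z$ write $Z_k=\ker(\partial|_{C_k})$ and let $r$ be the rank of $\partial_{k+1}\colon C_{k+1}\to Z_k$. A \emph{singular value decomposition} of $\partial_{k+1}$ consists of orthogonal ordered bases $(y_1,\dots,y_n)$ of $C_{k+1}$ and $(x_1,\dots,x_m)$ of $Z_k$ such that $(y_{r+1},\dots,y_n)$ is a basis of $\ker\partial_{k+1}$, $(x_1,\dots,x_r)$ is a basis of $\operatorname{im}\partial_{k+1}$, $\partial y_i=x_i$ for $i\le r$, and $\ell(y_1)-\ell(x_1)\ge\dots\ge\ell(y_r)-\ell(x_r)$. The associated \emph{degree-$k$ verbose barcode} is the finite multiset of elements of $(\mathbb R/\Gamma)\times[0,\infty]$ consisting of the pairs $([\ell(x_i)],\ell(y_i)-\ell(x_i))$ for $1\le i\le r$ and $([\ell(x_i)],\infty)$ for $r<i\le m$. For $a\in\mathbb R$, $L\in[0,\infty]$,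 $k\in\mathbb Z$ the \emph{elementary complex} $\mathcal E(a,L,k)$ is: if $L=\infty$, the complex $\Lambda x$ concentrated in degree $k$, with $\ell(\lambda x)=a-\nu(\lambda)$; if $L<\infty$, the complex with $\Lambda x$ in degree $k$, $\Lambda y$ in degree $k+1$, zero in all other degrees, $\partial y=x$, $\ell(\lambda x)=a-\nu(\lambda)$ and $\ell(\mu y)=a+L-\nu(\mu)$. A direct sum of complexes carries the function $\ell((c_\alpha)_\alpha)=\max_\alpha\ell(c_\alpha)$. \textbf{Theorem A.} (1) For every Floer-type complex over $\Lambda$ and every $k\in\mathbb Z$, the map $\partial_{k+1}\colon C_{k+1}\to Z_k$ has a singular value decomposition, and the degree-$k$ verbose barcode does not depend on the choice of singular value decomposition. (2) Two Floer-type complexes over $\Lambda$ are filtered chain isomorphic if and only if for every $k\in\mathbb Z$ their degree-$k$ verbose barcodes are equal. (3) Every Floer-type complex $(C_*,\partial,\ell)$ over $\Lambda$ is filtered chain isomorphic to $\bigoplus_{k\in\mathbb Z}\bigoplus_{([a],L)}\mathcal E(a,L,k)$, where for each $k$ the inner sum runs over the elements, with multiplicity, of the degree-$k$ verbose barcode of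 $C_*$, and $a\in\mathbb R$ is an arbitrarily chosen representative of $[a]\in\mathbb R/\Gamma$. -/

import Mathlib

open scoped DirectSum ENNReal
open CategoryTheory

universe u v w

namespace FloerNovikov

section NovikovField

/-- A Hahn series `∑ a_g T^g` is left-finite if `{g | a_g ≠ 0, g < C}` is finite for all `C : ℝ`. -/
def LeftFinite {K : Type u} [Field K] {Γ : AddSubgroup ℝ} (f : HahnSeries Γ K) : Prop :=
  ∀ C : ℝ, {g : Γ | f.coeff g ≠ 0 ∧ (g : ℝ) < C}.Finite

variable {K : Type u} [Field K] {Γ : AddSubgroup ℝ}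

theorem leftFinite_single (g : Γ) (c : K) : LeftFinite (HahnSeries.single g c) := by
  intro C
  refine (Set.finite_singleton g).subset ?_
  rintro h ⟨hh, -⟩
  by_contra hne
  exact hh (HahnSeries.coeff_single_of_ne hne)

theorem leftFinite_zero : LeftFinite (0 : HahnSeries Γ K) := by
  intro C; simp

theorem LeftFinite.add {f g : HahnSeries Γ K} (hf : LeftFinite f) (hg : LeftFinite g) :
    LeftFinite (f + g) := by
  intro C
  refine ((hf C).union (hg C)).subset ?_
  rintro h ⟨hh, hC⟩
  by_cases h0 : f.coeff h = 0
  · exact Or.inr ⟨by intro h1; simp [h0, h1] at hh, hC⟩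
  · exact Or.inl ⟨h0, hC⟩

theorem LeftFinite.neg {f : HahnSeries Γ K} (hf : LeftFinite f) : LeftFinite (-f) := by
  intro C
  simpa using hf C

theorem coeff_ne_zero_mul {f g : HahnSeries Γ K} {a : Γ} (h : (f * g).coeff a ≠ 0) :
    ∃ b c : Γ, f.coeff b ≠ 0 ∧ g.coeff c ≠ 0 ∧ b + c = a := by
  have h1 : a ∈ (f * g).support := h
  obtain ⟨b, hb, c, hc, rfl⟩ := HahnSeries.support_mul_subset h1
  exact ⟨b, c, hb, hc, rfl⟩

theorem LeftFinite.mul {f g : HahnSeries Γ K} (hf : LeftFinite f) (hg : LeftFinite g) :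
    LeftFinite (f * g) := by
  intro C
  refine ((hf (C - (g.order : ℝ))).add (hg (C - (f.order : ℝ)))).subset ?_
  rintro a ⟨ha, hC⟩
  obtain ⟨b, c, hb, hc, rfl⟩ := coeff_ne_zero_mul ha
  have h1 : (f.order : ℝ) ≤ (b : ℝ) := HahnSeries.order_le_of_coeff_ne_zero hb
  have h2 : (g.order : ℝ) ≤ (c : ℝ) := HahnSeries.order_le_of_coeff_ne_zero hc
  have h3 : (b : ℝ) + (c : ℝ) < C := by simpa using hC
  exact Set.add_mem_add ⟨hb, by linarith⟩ ⟨hc, by linarith⟩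

theorem leftFinite_of_recursion {s h g : HahnSeries Γ K} (hs : LeftFinite s) (hh : LeftFinite h)
    (hpos : ∀ a : Γ, h.coeff a ≠ 0 → 0 < (a : ℝ)) (hg : g = s + h * g) : LeftFinite g := by
  by_cases h0 : h = 0
  · rw [hg, h0, zero_mul, add_zero]; exact hs
  have hε : 0 < (h.order : ℝ) := hpos _ (by
    rw [HahnSeries.coeff_order_eq_zero.ne]; exact h0)
  have key : ∀ n : ℕ, {a : Γ | g.coeff a ≠ 0 ∧
      (a : ℝ) < (g.order : ℝ) + n * (h.order : ℝ)}.Finite := by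
    intro n
    induction n with
    | zero =>
      convert Set.finite_empty
      ext a
      simp only [Set.mem_ofPred_eq, Set.mem_empty_iff_false, iff_false, not_and, not_lt]
      intro ha
      have : (g.order : ℝ) ≤ (a : ℝ) := HahnSeries.order_le_of_coeff_ne_zero ha
      simpa using this
    | succ n ih =>
      refine ((hs ((g.order : ℝ) + (n + 1 : ℕ) * (h.order : ℝ))).union
        ((hh ((n + 1 : ℕ) * (h.order : ℝ))).add ih)).subset ?_
      rintro a ⟨ha, hC⟩
      by_cases h1 : s.coeff a = 0
      · right
        have h2 : (h * g).coeff a ≠ 0 := by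
          intro h3
          apply ha
          rw [hg, HahnSeries.coeff_add, h1, h3, add_zero]
        obtain ⟨b, c, hb, hc, rfl⟩ := coeff_ne_zero_mul h2
        have e1 : (h.order : ℝ) ≤ (b : ℝ) := HahnSeries.order_le_of_coeff_ne_zero hb
        have e2 : (g.order : ℝ) ≤ (c : ℝ) := HahnSeries.order_le_of_coeff_ne_zero hc
        have e3 : (b : ℝ) + (c : ℝ) < (g.order : ℝ) + (n + 1 : ℕ) * (h.order : ℝ) := by
          simpa using hC
        push_cast at e3
        refine Set.add_mem_add ⟨hb, ?_⟩ ⟨hc, ?_⟩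
        · push_cast; linarith
        · linarith
      · exact Or.inl ⟨h1, hC⟩
  intro C
  obtain ⟨n, hn⟩ := exists_nat_gt ((C - (g.order : ℝ)) / (h.order : ℝ))
  refine (key n).subset ?_
  rintro a ⟨ha, hC⟩
  refine ⟨ha, ?_⟩
  rw [div_lt_iff₀ hε] at hn
  linarith

theorem LeftFinite.inv {f : HahnSeries Γ K} (hf : LeftFinite f) : LeftFinite f⁻¹ := by
  by_cases h0 : f = 0
  · rw [h0, inv_zero]; exact leftFinite_zero
  set t : HahnSeries Γ K := HahnSeries.single (-f.order) (f.coeff f.order)⁻¹ with ht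
  have hlc : f.coeff f.order ≠ 0 := by
    rw [HahnSeries.coeff_order_eq_zero.ne]; exact h0
  have htf : LeftFinite t := leftFinite_single _ _
  have hcoeff : ∀ a : Γ, (f * t).coeff a = f.coeff (a + f.order) * (f.coeff f.order)⁻¹ := by
    intro a
    have := HahnSeries.coeff_mul_single_add (r := (f.coeff f.order)⁻¹) (x := f)
      (a := a + f.order) (b := -f.order)
    rw [add_neg_cancel_right] at this
    exact this
  refine leftFinite_of_recursion (s := t) (h := 1 + -(f * t)) htf
    ((leftFinite_single 0 1).add (hf.mul htf).neg) ?_ ?_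
  · intro a ha
    by_contra hneg
    apply ha
    rcases (not_lt.mp hneg).lt_or_eq with hlt | heq
    · have h1 : f.coeff (a + f.order) = 0 := by
        apply HahnSeries.coeff_eq_zero_of_lt_order
        have : a < 0 := hlt
        simpa using this
      have h2 : a ≠ 0 := by rintro rfl; simp at hlt
      simp [hcoeff, h1, HahnSeries.coeff_one, h2]
    · have h2 : a = 0 := Subtype.ext heq
      subst h2
      simp [hcoeff, HahnSeries.coeff_one, hlc]
  · have : f * f⁻¹ = 1 := mul_inv_cancel₀ h0
    calc f⁻¹ = t + f⁻¹ - t * (f * f⁻¹) := by rw [this]; ring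
      _ = _ := by ring

end NovikovField

/-- The Novikov field `Λ^{K,Γ}`, with the power series operations. -/
def novikovSubfield (K : Type u) [Field K] (Γ : AddSubgroup ℝ) : Subfield (HahnSeries Γ K) where
  carrier := {f | LeftFinite f}
  zero_mem' := leftFinite_zero
  one_mem' := leftFinite_single 0 1
  add_mem' := LeftFinite.add
  mul_mem' := LeftFinite.mul
  neg_mem' := LeftFinite.neg
  inv_mem' := fun _ => LeftFinite.inv

/-- The Novikov field `Λ^{K,Γ}` as a type. -/
abbrev Novikov (K : Type u) [Field K] (Γ : AddSubgroup ℝ) : Type u := novikovSubfield K Γ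

open Classical in
/-- The valuation `ν(∑ a_g T^g) = min {g | a_g ≠ 0}`, with `ν(0) = ∞`. -/
noncomputable def nu {K : Type u} [Field K] {Γ : AddSubgroup ℝ} (f : Novikov K Γ) : EReal :=
  if f = 0 then ⊤ else (((f : HahnSeries Γ K).order : ℝ) : EReal)

section NormedSpaces

variable (K : Type u) [Field K] (Γ : AddSubgroup ℝ)

/-- `(V, ℓ)` is a non-Archimedean normed vector space over `Λ`; here `ℓ : V → ℝ ∪ {-∞}`, so the
value `⊤` of `EReal` is excluded. -/
structure IsNonArchNormed {V : Type v} [AddCommGroup V] [Module (Novikov K Γ) V]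
    (ℓ : V → EReal) : Prop where
  ne_top : ∀ x, ℓ x ≠ ⊤
  eq_bot_iff : ∀ x, ℓ x = ⊥ ↔ x = 0
  smul : ∀ (c : Novikov K Γ) (x : V), ℓ (c • x) = ℓ x - nu c
  add_le : ∀ x y, ℓ (x + y) ≤ max (ℓ x) (ℓ y)

/-- A finite family is orthogonal if `ℓ(∑ λ_i w_i) = max_i ℓ(λ_i w_i)` for all `λ_i ∈ Λ`
(the maximum of the empty family is `-∞`). -/
def IsOrthogonal {V : Type v} [AddCommGroup V] [Module (Novikov K Γ) V]
    (ℓ : V → EReal) {n : ℕ} (e : Fin n → V) : Prop :=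
  ∀ c : Fin n → Novikov K Γ,
    ℓ (∑ i, c i • e i) = Finset.univ.sup (fun i => ℓ (c i • e i))

/-- `(V, ℓ)` is an orthogonalizable `Λ`-space: a finite-dimensional non-Archimedean normed vector
space having an orthogonal basis. -/
def IsOrthogonalizable {V : Type v} [AddCommGroup V] [Module (Novikov K Γ) V]
    (ℓ : V → EReal) : Prop :=
  IsNonArchNormed K Γ ℓ ∧
    ∃ (n : ℕ) (e : Module.Basis (Fin n) (Novikov K Γ) V), IsOrthogonal K Γ ℓ e

variable {K Γ}

/-- A singular value decomposition of `A : V → W`: ordered orthogonal bases `(y_0, …, y_{n-1})` of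
`V` and `(x_0, …, x_{m-1})` of `W` such that, with `r = rank A`, the `y_i` with `i ≥ r` span `ker A`,
the `x_i` with `i < r` span `im A`, `A y_i = x_i` for `i < r`, and the numbers `ℓ(y_i) - ℓ(x_i)`,
`i < r`, are nonincreasing. -/
structure SVD {V : Type v} {W : Type w} [AddCommGroup V] [Module (Novikov K Γ) V]
    [AddCommGroup W] [Module (Novikov K Γ) W] (ℓV : V → EReal) (ℓW : W → EReal)
    (A : V →ₗ[Novikov K Γ] W) where
  n : ℕ
  m : ℕ
  y : Module.Basis (Fin n) (Novikov K Γ) V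
  x : Module.Basis (Fin m) (Novikov K Γ) W
  orthogonal_y : IsOrthogonal K Γ ℓV y
  orthogonal_x : IsOrthogonal K Γ ℓW x
  span_ker : Submodule.span (Novikov K Γ)
    {v | ∃ i : Fin n, Module.finrank (Novikov K Γ) (LinearMap.range A) ≤ i ∧ y i = v} =
      LinearMap.ker A
  span_range : Submodule.span (Novikov K Γ)
    {z | ∃ i : Fin m, (i : ℕ) < Module.finrank (Novikov K Γ) (LinearMap.range A) ∧ x i = z} =
      LinearMap.range A
  map_eq : ∀ (i : Fin n) (j : Fin m), (i : ℕ) = j →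
    (i : ℕ) < Module.finrank (Novikov K Γ) (LinearMap.range A) → A (y i) = x j
  sorted : ∀ (i i' : Fin n) (j j' : Fin m), (i : ℕ) = j → (i' : ℕ) = j' → i ≤ i' →
    (i' : ℕ) < Module.finrank (Novikov K Γ) (LinearMap.range A) →
      ℓV (y i') - ℓW (x j') ≤ ℓV (y i) - ℓW (x j)

theorem SVD.rank_le {V : Type v} {W : Type w} [AddCommGroup V] [Module (Novikov K Γ) V]
    [AddCommGroup W] [Module (Novikov K Γ) W] {ℓV : V → EReal} {ℓW : W → EReal}
    {A : V →ₗ[Novikov K Γ] W} (s : SVD ℓV ℓW A) :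
    Module.finrank (Novikov K Γ) (LinearMap.range A) ≤ s.n := by
  have : Module.Finite (Novikov K Γ) V := Module.Finite.of_basis s.y
  have h := LinearMap.finrank_range_le A
  rwa [Module.finrank_eq_card_basis s.y, Fintype.card_fin] at h

/-- The multiset of pairs `([ℓ(x_i)], ℓ(y_i) - ℓ(x_i))` for `i < r` and `([ℓ(x_i)], ∞)` for
`r ≤ i`, where `r = rank A` and `[a]` is the class of `a` in `ℝ / Γ`. -/
noncomputable def SVD.bars {V : Type v} {W : Type w} [AddCommGroup V] [Module (Novikov K Γ) V]
    [AddCommGroup W] [Module (Novikov K Γ) W] {ℓV : V → EReal} {ℓW : W → EReal}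
    {A : V →ₗ[Novikov K Γ] W} (s : SVD ℓV ℓW A) : Multiset ((ℝ ⧸ Γ) × ℝ≥0∞) :=
  (Finset.univ : Finset (Fin s.m)).val.map fun i =>
    (((ℓW (s.x i)).toReal : ℝ ⧸ Γ),
      if h : (i : ℕ) < Module.finrank (Novikov K Γ) (LinearMap.range A) then
        (ℓV (s.y ⟨i, h.trans_le s.rank_le⟩) - ℓW (s.x i)).toENNReal
      else ⊤)

end NormedSpaces

/-- A `ℤ`-graded chain complex of `Λ`-vector spaces with a function `ℓ` on every graded piece;
`IsFloerType` below says when it is a Floer-type complex. -/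
structure FilteredComplex (K : Type u) [Field K] (Γ : AddSubgroup ℝ) where
  toComplex : ChainComplex (ModuleCat.{v} (Novikov K Γ)) ℤ
  ℓ : ∀ k : ℤ, toComplex.X k → EReal

namespace FilteredComplex

variable {K : Type u} [Field K] {Γ : AddSubgroup ℝ}

/-- The boundary operator from degree `i` to degree `j` (it is zero unless `i = j + 1`). -/
noncomputable abbrev bd (C : FilteredComplex.{u, v} K Γ) (i j : ℤ) :
    C.toComplex.X i →ₗ[Novikov K Γ] C.toComplex.X j :=
  (C.toComplex.d i j).hom

theorem bd_bd (C : FilteredComplex.{u, v} K Γ) (i j l : ℤ) (x : C.toComplex.X i) :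
    C.bd j l (C.bd i j x) = 0 :=
  LinearMap.congr_fun (congrArg ModuleCat.Hom.hom (C.toComplex.d_comp_d i j l)) x

theorem bd_eq_zero (C : FilteredComplex.{u, v} K Γ) {i j : ℤ}
    (h : ¬ (ComplexShape.down ℤ).Rel i j) (x : C.toComplex.X i) : C.bd i j x = 0 :=
  LinearMap.congr_fun (congrArg ModuleCat.Hom.hom (C.toComplex.shape i j h)) x

/-- Floer-type complex: every `(C_k, ℓ)` is an orthogonalizable `Λ`-space, and `ℓ(∂x) ≤ ℓ(x)`. -/
structure IsFloerType (C : FilteredComplex.{u, v} K Γ) : Prop where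
  orthogonalizable : ∀ k, IsOrthogonalizable K Γ (C.ℓ k)
  bd_le : ∀ (k : ℤ) (x : C.toComplex.X (k + 1)), C.ℓ k (C.bd (k + 1) k x) ≤ C.ℓ (k + 1) x

/-- A filtered chain isomorphism: a chain isomorphism that preserves `ℓ` exactly. -/
structure FilteredIso (C : FilteredComplex.{u, v} K Γ) (D : FilteredComplex.{u, w} K Γ) where
  toEquiv : ∀ k : ℤ, C.toComplex.X k ≃ₗ[Novikov K Γ] D.toComplex.X k
  comm : ∀ (i j : ℤ) (x : C.toComplex.X i), toEquiv j (C.bd i j x) = D.bd i j (toEquiv i x)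
  map_ℓ : ∀ (k : ℤ) (x : C.toComplex.X k), D.ℓ k (toEquiv k x) = C.ℓ k x

/-- The cycles `Z_k = ker ∂_k`. -/
noncomputable abbrev cycles (C : FilteredComplex.{u, v} K Γ) (k : ℤ) :
    Submodule (Novikov K Γ) (C.toComplex.X k) :=
  LinearMap.ker (C.bd k (k - 1))

/-- The boundary operator as a map `∂_{k+1} : C_{k+1} → Z_k`. -/
noncomputable def bdToCycles (C : FilteredComplex.{u, v} K Γ) (k : ℤ) :
    C.toComplex.X (k + 1) →ₗ[Novikov K Γ] C.cycles k :=
  LinearMap.codRestrict (C.cycles k) (C.bd (k + 1) k) fun x =>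
    C.bd_bd (k + 1) k (k - 1) x

/-- Singular value decompositions of `∂_{k+1} : C_{k+1} → Z_k`. -/
abbrev BoundarySVD (C : FilteredComplex.{u, v} K Γ) (k : ℤ) :=
  SVD (C.ℓ (k + 1)) (fun z : C.cycles k => C.ℓ k z) (C.bdToCycles k)

open Classical in
/-- The degree-`k` verbose barcode, read off from a chosen singular value decomposition of
`∂_{k+1} : C_{k+1} → Z_k` (and `0` if there is none). -/
noncomputable def verboseBarcode (C : FilteredComplex.{u, v} K Γ) (k : ℤ) :
    Multiset ((ℝ ⧸ Γ) × ℝ≥0∞) :=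
  if h : Nonempty (C.BoundarySVD k) then (Classical.choice h).bars else 0

/-- The direct sum of a family of filtered complexes, with `ℓ((c_i)_i) = max_i ℓ(c_i)`. -/
noncomputable def directSum {ι : Type w} (C : ι → FilteredComplex.{u, v} K Γ) :
    FilteredComplex.{u, max w v} K Γ where
  toComplex :=
    { X := fun k => ModuleCat.of (Novikov K Γ) (⨁ i, (C i).toComplex.X k)
      d := fun k l => ModuleCat.ofHom (DirectSum.lmap fun i => (C i).bd k l)
      shape := fun k l h => by
        ext x : 2
        refine DFinsupp.ext fun i => ?_
        exact (C i).bd_eq_zero h (x i)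
      d_comp_d' := fun k l m _ _ => by
        ext x : 2
        refine DFinsupp.ext fun i => ?_
        exact (C i).bd_bd k l m (x i) }
  ℓ := fun k (c : ⨁ i, (C i).toComplex.X k) => ⨆ i, (C i).ℓ k (c i)

end FilteredComplex

section Elementary

variable (K : Type u) [Field K] (Γ : AddSubgroup ℝ)

/-- The degree-`m` part of `E(a, L, k)`, inside the space `Λx ⊕ Λy` whose elements `λx + μy` are
written `(λ, μ)`: the generator `x` lives in degree `k`, and `y` lives in degree `k + 1` and is
present only if `L < ∞`. -/
def elementaryX (L : ℝ≥0∞) (k m : ℤ) :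
    Submodule (Novikov K Γ) (Novikov K Γ × Novikov K Γ) where
  carrier := {e | (m ≠ k → e.1 = 0) ∧ (¬(m = k + 1 ∧ L ≠ ⊤) → e.2 = 0)}
  zero_mem' := ⟨fun _ => rfl, fun _ => rfl⟩
  add_mem' := fun {e f} he hf =>
    ⟨fun h => by simp [he.1 h, hf.1 h], fun h => by simp [he.2 h, hf.2 h]⟩
  smul_mem' := fun c e he => ⟨fun h => by simp [he.1 h], fun h => by simp [he.2 h]⟩

/-- The boundary operator `∂(λx + μy) = μx` of `E(a, L, k)`, from degree `i` to degree `j`. -/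
noncomputable def elementaryBd (L : ℝ≥0∞) (k i j : ℤ) :
    elementaryX K Γ L k i →ₗ[Novikov K Γ] elementaryX K Γ L k j :=
  if h : i = j + 1 then
    { toFun := fun e => ⟨(e.1.2, 0), fun hj => e.2.2 fun hi => hj (by omega), fun _ => rfl⟩
      map_add' := fun e f => by ext <;> simp
      map_smul' := fun c e => by ext <;> simp }
  else 0

/-- The elementary Floer-type complex `E(a, L, k)`, with
`ℓ(λx + μy) = max {a - ν(λ), (a + L) - ν(μ)}`. -/
noncomputable def elementary (a : ℝ) (L : ℝ≥0∞) (k : ℤ) : FilteredComplex.{u, u} K Γ where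
  toComplex :=
    { X := fun m => ModuleCat.of (Novikov K Γ) (elementaryX K Γ L k m)
      d := fun i j => ModuleCat.ofHom (elementaryBd K Γ L k i j)
      shape := fun i j h => by
        have h' : ¬ i = j + 1 := fun e => h e.symm
        simp only [elementaryBd, dif_neg h']
        rfl
      d_comp_d' := fun i j l hij hjl => by
        have h1 : i = j + 1 := hij.symm
        have h2 : j = l + 1 := hjl.symm
        ext x : 2
        simp only [elementaryBd, dif_pos h1, dif_pos h2]
        rfl }
  ℓ := fun m (e : elementaryX K Γ L k m) =>
    max ((a : EReal) - nu e.1.1) (((a : EReal) + (L : EReal)) - nu e.1.2)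

end Elementary

end FloerNovikov

open FloerNovikov FilteredComplex

/-! Everything comes down to linear algebra for a single boundary map $A$ over a valued field.

Existence is Gaussian elimination in which the pivot is a nonzero entry $c_{ij}$ of $A$ maximizing
$\ell(c_{ij}x_j)-\ell(y_i)$. Maximality within the expansion of the pivot's image says that this
image is dominated by its $x_{j_0}$-component, so it may replace $x_{j_0}$ without spoiling
orthogonality (`Orthogonal.update`). Maximality among the coefficients of $x_{j_0}$ says that the
multiples of $y_{i_0}$ needed to clear the other images are no larger than the vectors they are
subtracted from, so the source stays orthogonal too (`Orthogonal.sub_multiples`). The outcome is a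
partial matching of orthogonal bases (`exists_matching`). Its unmatched source vectors span the
kernel, which makes $Z_k$ orthogonalizable; for $\partial_{k+1}$, sorting the matched pairs gives a
singular value decomposition.

Uniqueness holds because each multiplicity is the dimension over $\mathcal K$ of a quotient
$M/(M\cap N)$ defined without bases. For $([a],\infty)$ take $M=\{\ell\le a\}$ and
$N=\operatorname{im}A+\{\ell<a\}$. For finite $L$ take $M=\{Av : \ell(Av)\le a,\ \ell(v)\le a+L\}$
and $N=A\{\ell<a+L\}+\{\ell<a\}$. In any decomposition, the coefficients at $T^{\ell(x_i)-a}$ of the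
coordinates belonging to these bars are coordinates on the quotient. `card_le_of_leading_coeffs`
compares two such systems directly.

For the normal form, multiplying $x_i$ and $y_i$ by a common monomial moves $\ell(x_i)$ to any
representative of its class and keeps the bar length. The rescaled $x$'s of degree $m$ and $y$'s of
degree $m-1$ then define a level-preserving chain map from the sum of elementary complexes;
preserving levels forces injectivity. The classification follows: isomorphisms transport
decompositions, and equal barcodes give a common normal form. -/

namespace FloerNovikov

/-! ### The valuation and the coefficients of Novikov series -/

section Valuation

variable {K : Type u} [Field K] {Γ : AddSubgroup ℝ}

theorem nu_zero : nu (0 : Novikov K Γ) = ⊤ := if_pos rfl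

theorem nu_of_ne_zero {c : Novikov K Γ} (hc : c ≠ 0) :
    nu c = (((c : HahnSeries Γ K).order : ℝ) : EReal) := if_neg hc

theorem nu_mul (c d : Novikov K Γ) : nu (c * d) = nu c + nu d := by
  by_cases hc : c = 0
  · rw [hc, zero_mul, nu_zero]
    by_cases hd : d = 0
    · rw [hd, nu_zero]; rfl
    · rw [nu_of_ne_zero hd, EReal.top_add_coe]
  by_cases hd : d = 0
  · rw [hd, mul_zero, nu_zero, nu_of_ne_zero hc, EReal.coe_add_top]
  rw [nu_of_ne_zero (mul_ne_zero hc hd), nu_of_ne_zero hc, nu_of_ne_zero hd, ← EReal.coe_add]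
  have h1 : (c : HahnSeries Γ K) ≠ 0 := fun h => hc (Subtype.ext h)
  have h2 : (d : HahnSeries Γ K) ≠ 0 := fun h => hd (Subtype.ext h)
  have h3 : ((c * d : Novikov K Γ) : HahnSeries Γ K).order =
      (c : HahnSeries Γ K).order + (d : HahnSeries Γ K).order := HahnSeries.order_mul h1 h2
  rw [h3]; norm_cast

theorem nu_one : nu (1 : Novikov K Γ) = 0 := by
  rw [nu_of_ne_zero one_ne_zero]
  have : ((1 : Novikov K Γ) : HahnSeries Γ K).order = 0 := HahnSeries.order_one
  rw [this]; simp

theorem nu_neg (c : Novikov K Γ) : nu (-c) = nu c := by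
  by_cases hc : c = 0
  · rw [hc, neg_zero]
  rw [nu_of_ne_zero (neg_ne_zero.mpr hc), nu_of_ne_zero hc]
  have : ((-c : Novikov K Γ) : HahnSeries Γ K).order = (c : HahnSeries Γ K).order :=
    HahnSeries.order_neg
  rw [this]

/-- The monomial `c T^g`. -/
noncomputable def monomial (g : Γ) (c : K) : Novikov K Γ :=
  ⟨HahnSeries.single g c, leftFinite_single g c⟩

theorem monomial_ne_zero (g : Γ) : (monomial g 1 : Novikov K Γ) ≠ 0 := fun h =>
  one_ne_zero (HahnSeries.single_eq_zero_iff.mp (congrArg Subtype.val h) : (1 : K) = 0)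

theorem nu_monomial (g : Γ) : nu (monomial g 1 : Novikov K Γ) = ((g : ℝ) : EReal) := by
  rw [nu_of_ne_zero (monomial_ne_zero g)]
  have : ((monomial g 1 : Novikov K Γ) : HahnSeries Γ K).order = g :=
    HahnSeries.order_single one_ne_zero
  rw [this]

/-- The coefficient of `T^g`. -/
def coeffAt (g : Γ) (c : Novikov K Γ) : K := (c : HahnSeries Γ K).coeff g

@[simp] theorem coeffAt_zero (g : Γ) : coeffAt g (0 : Novikov K Γ) = 0 := rfl

@[simp] theorem coeffAt_add (g : Γ) (c d : Novikov K Γ) :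
    coeffAt g (c + d) = coeffAt g c + coeffAt g d := rfl

theorem coeffAt_sum {ι : Type*} (s : Finset ι) (g : Γ) (c : ι → Novikov K Γ) :
    coeffAt g (∑ i ∈ s, c i) = ∑ i ∈ s, coeffAt g (c i) := by
  classical
  induction s using Finset.induction_on with
  | empty => rfl
  | insert a s ha ih => rw [Finset.sum_insert ha, Finset.sum_insert ha, coeffAt_add, ih]

theorem coeffAt_monomial_self (g : Γ) (c : K) : coeffAt g (monomial g c : Novikov K Γ) = c :=
  HahnSeries.coeff_single_same g c

theorem coeffAt_monomial_mul (g h : Γ) (c : K) (d : Novikov K Γ) :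
    coeffAt h (monomial g c * d) = c * coeffAt (h - g) d := by
  have := HahnSeries.coeff_single_mul_add (r := c) (x := (d : HahnSeries Γ K)) (a := h - g) (b := g)
  rw [sub_add_cancel] at this
  exact this

/-- Translates a bound on levels into a bound on the exponents that occur. Compared with the strict
version below, the only extra exponent allowed is $g=b-s$; this gap is what leading coefficients
detect. -/
theorem coe_sub_nu_le {b s : ℝ} {c : Novikov K Γ} :
    (b : EReal) - nu c ≤ s ↔ ∀ g : Γ, coeffAt g c ≠ 0 → b - s ≤ (g : ℝ) := by
  by_cases hc : c = 0
  · simp [hc, nu_zero]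
  have hc' : (c : HahnSeries Γ K) ≠ 0 := fun h => hc (Subtype.ext h)
  rw [nu_of_ne_zero hc, ← EReal.coe_sub, EReal.coe_le_coe_iff]
  constructor
  · intro h g hg
    have h1 : ((c : HahnSeries Γ K).order : ℝ) ≤ (g : ℝ) := HahnSeries.order_le_of_coeff_ne_zero hg
    linarith
  · intro h
    have := h _ ((HahnSeries.coeff_order_eq_zero.ne).mpr hc')
    linarith

theorem coe_sub_nu_lt {b s : ℝ} {c : Novikov K Γ} :
    (b : EReal) - nu c < s ↔ ∀ g : Γ, coeffAt g c ≠ 0 → b - s < (g : ℝ) := by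
  by_cases hc : c = 0
  · simp [hc, nu_zero]
  have hc' : (c : HahnSeries Γ K) ≠ 0 := fun h => hc (Subtype.ext h)
  rw [nu_of_ne_zero hc, ← EReal.coe_sub, EReal.coe_lt_coe_iff]
  constructor
  · intro h g hg
    have h1 : ((c : HahnSeries Γ K).order : ℝ) ≤ (g : ℝ) := HahnSeries.order_le_of_coeff_ne_zero hg
    linarith
  · intro h
    have := h _ ((HahnSeries.coeff_order_eq_zero.ne).mpr hc')
    linarith

end Valuation

/-! ### Orthogonal families and the moves that preserve them -/

section Norm

variable {K : Type u} [Field K] {Γ : AddSubgroup ℝ}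
variable {V : Type v} [AddCommGroup V] [Module (Novikov K Γ) V] {ℓ : V → EReal}

namespace IsNonArchNormed

theorem map_zero (h : IsNonArchNormed K Γ ℓ) : ℓ 0 = ⊥ := (h.eq_bot_iff 0).mpr rfl

theorem map_neg (h : IsNonArchNormed K Γ ℓ) (x : V) : ℓ (-x) = ℓ x := by
  rw [← neg_one_smul (Novikov K Γ) x, h.smul, nu_neg, nu_one, sub_zero]

theorem sub_le (h : IsNonArchNormed K Γ ℓ) (x y : V) : ℓ (x - y) ≤ max (ℓ x) (ℓ y) := by
  rw [sub_eq_add_neg, ← h.map_neg y]; exact h.add_le _ _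

theorem sum_le (h : IsNonArchNormed K Γ ℓ) {ι : Type*} (s : Finset ι) (f : ι → V) {b : EReal}
    (hb : ∀ i ∈ s, ℓ (f i) ≤ b) : ℓ (∑ i ∈ s, f i) ≤ b := by
  classical
  induction s using Finset.induction_on with
  | empty => rw [Finset.sum_empty, h.map_zero]; exact bot_le
  | insert a s ha ih =>
    rw [Finset.sum_insert ha]
    exact (h.add_le _ _).trans (max_le (hb _ (Finset.mem_insert_self _ _))
      (ih fun i hi => hb i (Finset.mem_insert_of_mem hi)))

theorem smul_mono (h : IsNonArchNormed K Γ ℓ) (c : Novikov K Γ) {x y : V} (hxy : ℓ x ≤ ℓ y) :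
    ℓ (c • x) ≤ ℓ (c • y) := by
  rw [h.smul, h.smul]; exact EReal.sub_le_sub hxy le_rfl

theorem eq_coe (h : IsNonArchNormed K Γ ℓ) {x : V} (hx : x ≠ 0) :
    ℓ x = ((ℓ x).toReal : EReal) :=
  (EReal.coe_toReal (h.ne_top x) fun hb => hx ((h.eq_bot_iff x).mp hb)).symm

theorem comp_injective (h : IsNonArchNormed K Γ ℓ) {W : Type w} [AddCommGroup W]
    [Module (Novikov K Γ) W] (f : W →ₗ[Novikov K Γ] V) (hf : Function.Injective f) :
    IsNonArchNormed K Γ (fun w => ℓ (f w)) where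
  ne_top x := h.ne_top _
  eq_bot_iff x := by rw [h.eq_bot_iff, map_eq_zero_iff f hf]
  smul c x := by simp only [map_smul, h.smul]
  add_le x y := by simp only [map_add]; exact h.add_le _ _

end IsNonArchNormed

/-- Orthogonality of a family with an arbitrary finite index type. -/
def Orthogonal {ι : Type*} [Fintype ι] (ℓ : V → EReal) (e : ι → V) : Prop :=
  ∀ (c : ι → Novikov K Γ) (i : ι), ℓ (c i • e i) ≤ ℓ (∑ j, c j • e j)

/-- `Orthogonal` demands only that each term be bounded by the sum; the reverse inequality is the
ultrametric one. -/
theorem Orthogonal.eq_sup {ι : Type*} [Fintype ι] {e : ι → V} (h : IsNonArchNormed K Γ ℓ)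
    (he : Orthogonal (K := K) (Γ := Γ) ℓ e) (c : ι → Novikov K Γ) :
    ℓ (∑ i, c i • e i) = Finset.univ.sup (fun i => ℓ (c i • e i)) :=
  le_antisymm (h.sum_le _ _ fun _ hi => Finset.le_sup (f := fun i => ℓ (c i • e i)) hi)
    (Finset.sup_le fun i _ => he c i)

theorem IsOrthogonal.orthogonal {n : ℕ} {e : Fin n → V} (he : IsOrthogonal K Γ ℓ e) :
    Orthogonal (K := K) (Γ := Γ) ℓ e := fun c i => by
  rw [he c]; exact Finset.le_sup (f := fun i => ℓ (c i • e i)) (Finset.mem_univ i)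

theorem Orthogonal.isOrthogonal {n : ℕ} {e : Fin n → V} (h : IsNonArchNormed K Γ ℓ)
    (he : Orthogonal (K := K) (Γ := Γ) ℓ e) : IsOrthogonal K Γ ℓ e := he.eq_sup h

theorem Orthogonal.reindex {ι κ : Type*} [Fintype ι] [Fintype κ] {e : ι → V}
    (he : Orthogonal (K := K) (Γ := Γ) ℓ e) (σ : κ ≃ ι) :
    Orthogonal (K := K) (Γ := Γ) ℓ (e ∘ σ) := fun c i => by
  have := he (c ∘ σ.symm) (σ i)
  rw [← Equiv.sum_comp σ] at this
  simpa using this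

theorem Orthogonal.linearIndependent {ι : Type*} [Fintype ι] {e : ι → V}
    (h : IsNonArchNormed K Γ ℓ) (he : Orthogonal (K := K) (Γ := Γ) ℓ e) (h0 : ∀ i, e i ≠ 0) :
    LinearIndependent (Novikov K Γ) e := by
  rw [Fintype.linearIndependent_iff]
  intro c hc i
  have h1 := he c i
  rw [hc, h.map_zero, le_bot_iff, h.eq_bot_iff, smul_eq_zero] at h1
  exact h1.resolve_right (h0 i)

/-- Nonzero orthogonal vectors are independent, and being indexed by the index set of a basis they
are numerous enough to span. -/
theorem Orthogonal.exists_basis {ι : Type*} [Fintype ι] {e : ι → V}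
    (h : IsNonArchNormed K Γ ℓ) (he : Orthogonal (K := K) (Γ := Γ) ℓ e) (h0 : ∀ i, e i ≠ 0)
    (b : Module.Basis ι (Novikov K Γ) V) :
    ∃ b' : Module.Basis ι (Novikov K Γ) V, ⇑b' = e := by
  have := Module.Finite.of_basis b
  have hli := he.linearIndependent h h0
  have := hli.span_eq_top_of_card_eq_finrank' (Module.finrank_eq_card_basis b).symm
  exact ⟨Module.Basis.mk hli this.ge, Module.Basis.coe_mk _ _⟩

theorem Orthogonal.repr_le {ι : Type*} [Fintype ι] {b : Module.Basis ι (Novikov K Γ) V}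
    (hb : Orthogonal (K := K) (Γ := Γ) ℓ b) (v : V) (i : ι) : ℓ (b.repr v i • b i) ≤ ℓ v := by
  have := hb (b.repr v) i
  rwa [b.sum_repr] at this

theorem Orthogonal.le_of_repr {ι : Type*} [Fintype ι] {b : Module.Basis ι (Novikov K Γ) V}
    (h : IsNonArchNormed K Γ ℓ) {v : V} {s : EReal} (hs : ∀ i, ℓ (b.repr v i • b i) ≤ s) :
    ℓ v ≤ s := by
  rw [← b.sum_repr v]; exact h.sum_le _ _ fun i _ => hs i

/-- Subtracting from the vectors of an orthogonal family multiples, of no greater size, of one of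
them. -/
theorem Orthogonal.sub_multiples {ι : Type*} [Fintype ι] {e : ι → V}
    (h : IsNonArchNormed K Γ ℓ) (he : Orthogonal (K := K) (Γ := Γ) ℓ e) (i₀ : ι)
    (c : ι → Novikov K Γ) (hc0 : c i₀ = 0) (hc : ∀ i, ℓ (c i • e i₀) ≤ ℓ (e i)) :
    Orthogonal (K := K) (Γ := Γ) ℓ (fun i => e i - c i • e i₀) := by
  classical
  intro b i
  set w := ∑ j, b j • (e j - c j • e i₀) with hw
  have hw' : w = ∑ j, (b j - if j = i₀ then ∑ k, b k * c k else 0) • e j := by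
    simp only [hw, smul_sub, sub_smul, Finset.sum_sub_distrib, ite_smul, zero_smul,
      Finset.sum_ite_eq', Finset.mem_univ, if_true, Finset.sum_smul, mul_smul]
  -- Expanding in the old family changes only the coefficient of $e_{i_0}$, so the other terms are
  -- bounded first. By `hc` they bound the corrections along $e_{i_0}$, and these in turn bound the
  -- remaining term.
  have h1 : ∀ j, j ≠ i₀ → ℓ (b j • e j) ≤ ℓ w := by
    intro j hj
    have := he (fun j => b j - if j = i₀ then ∑ k, b k * c k else 0) j
    rwa [← hw', if_neg hj, sub_zero] at this
  have h2 : ∀ j, ℓ ((b j * c j) • e i₀) ≤ ℓ w := by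
    intro j
    by_cases hj : j = i₀
    · rw [hj, hc0, mul_zero, zero_smul, h.map_zero]; exact bot_le
    · rw [mul_smul]; exact (h.smul_mono _ (hc j)).trans (h1 j hj)
  have h3 : ∀ j, ℓ (b j • e j) ≤ ℓ w := by
    intro j
    by_cases hj : j = i₀
    · subst hj
      have h4 := he (fun i => b i - if i = j then ∑ k, b k * c k else 0) j
      rw [← hw', if_pos rfl] at h4
      have h5 : b j • e j = (b j - ∑ k, b k * c k) • e j + ∑ k, (b k * c k) • e j := by
        rw [sub_smul, ← Finset.sum_smul, sub_add_cancel]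
      rw [h5]
      exact (h.add_le _ _).trans (max_le h4 (h.sum_le _ _ fun k _ => h2 k))
    · exact h1 j hj
  rw [smul_sub, smul_smul]
  exact (h.sub_le _ _).trans (max_le (h3 i) (h2 i))

/-- Replacing one vector of an orthogonal basis by a vector whose dominant component is in the
direction of the replaced vector. -/
theorem Orthogonal.update {ι : Type*} [Fintype ι] [DecidableEq ι]
    {b : Module.Basis ι (Novikov K Γ) V} (h : IsNonArchNormed K Γ ℓ)
    (hb : Orthogonal (K := K) (Γ := Γ) ℓ b) (z : V) (j₀ : ι)
    (hz : ∀ j, ℓ (b.repr z j • b j) ≤ ℓ (b.repr z j₀ • b j₀)) :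
    Orthogonal (K := K) (Γ := Γ) ℓ (Function.update b j₀ z) := by
  intro c
  set w := ∑ j, c j • Function.update b j₀ z j with hw
  have hw0 : w = (∑ j, (if j = j₀ then 0 else c j) • b j) + c j₀ • z := by
    have h1 : ∀ j, c j • Function.update b j₀ z j =
        (if j = j₀ then 0 else c j) • b j + if j = j₀ then c j₀ • z else 0 := by
      intro j
      by_cases hj : j = j₀
      · subst hj; simp
      · simp [hj]
    rw [hw, Finset.sum_congr rfl fun j _ => h1 j, Finset.sum_add_distrib]
    simp
  have hrep : ∀ j, b.repr w j = (if j = j₀ then 0 else c j) + c j₀ * b.repr z j := by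
    intro j
    rw [hw0, map_add, Finsupp.add_apply, Module.Basis.repr_sum_self, map_smul, Finsupp.smul_apply,
      smul_eq_mul]
  have hz0 : ℓ z ≤ ℓ (b.repr z j₀ • b j₀) := Orthogonal.le_of_repr h hz
  -- Only $z$ contributes to the $j_0$-coordinate of $w$. This bounds $c_{j_0}z$ together with all
  -- its components, and the other terms follow by subtraction.
  have hd : ℓ ((c j₀ * b.repr z j₀) • b j₀) ≤ ℓ w := by
    have := hb.repr_le w j₀
    rwa [hrep, if_pos rfl, zero_add] at this
  have hd' : ∀ j, ℓ ((c j₀ * b.repr z j) • b j) ≤ ℓ w := fun j => by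
    rw [mul_smul] at hd ⊢
    exact (h.smul_mono _ (hz j)).trans hd
  intro j
  by_cases hj : j = j₀
  · subst hj
    rw [Function.update_self]
    rw [mul_smul] at hd
    exact (h.smul_mono _ hz0).trans hd
  · rw [Function.update_of_ne hj]
    have h1 := hb.repr_le w j
    have h2 : c j • b j = b.repr w j • b j - (c j₀ * b.repr z j) • b j := by
      rw [hrep, if_neg hj, add_smul, add_sub_cancel_right]
    rw [h2]
    exact (h.sub_le _ _).trans (max_le h1 (hd' j))

end Norm

end FloerNovikov
namespace FloerNovikov

/-! ### Gaussian elimination with maximal pivots -/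

section Elimination

variable {K : Type u} [Field K] {Γ : AddSubgroup ℝ}
variable {V : Type v} [AddCommGroup V] [Module (Novikov K Γ) V] {ℓV : V → EReal}
variable {W : Type w} [AddCommGroup W] [Module (Novikov K Γ) W] {ℓW : W → EReal}

/-- This is the pivot inequality rewritten: both sides contain the same $\ell(x)$, which cancels,
leaving $\ell(y)-\nu(c)+\nu(d)\le\ell(y')$. -/
theorem IsNonArchNormed.div_smul_le (hV : IsNonArchNormed K Γ ℓV) (hW : IsNonArchNormed K Γ ℓW)
    {c d : Novikov K Γ} {x : W} {y y' : V} (hd : d ≠ 0) (hx : x ≠ 0) (hy : y ≠ 0) (hy' : y' ≠ 0)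
    (hle : c ≠ 0 → ℓW (c • x) - ℓV y' ≤ ℓW (d • x) - ℓV y) : ℓV ((c / d) • y) ≤ ℓV y' := by
  by_cases hc : c = 0
  · rw [hc, zero_div, zero_smul, hV.map_zero]; exact bot_le
  have h1 := hle hc
  have h2 : c = (c / d) * d := (div_mul_cancel₀ c hd).symm
  have h3 : nu c = nu (c / d) + nu d := by rw [← nu_mul, ← h2]
  rw [nu_of_ne_zero hc, nu_of_ne_zero (div_ne_zero hc hd), nu_of_ne_zero hd, ← EReal.coe_add,
    EReal.coe_eq_coe_iff] at h3
  rw [hV.smul, nu_of_ne_zero (div_ne_zero hc hd), hV.eq_coe hy, hV.eq_coe hy', ← EReal.coe_sub,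
    EReal.coe_le_coe_iff]
  rw [hW.smul, hW.smul, nu_of_ne_zero hc, nu_of_ne_zero hd, hV.eq_coe hy, hV.eq_coe hy',
    hW.eq_coe hx, ← EReal.coe_sub, ← EReal.coe_sub, ← EReal.coe_sub, ← EReal.coe_sub,
    EReal.coe_le_coe_iff] at h1
  linarith

/-- The expansion of $w$ does not involve the replaced vector, so the same expansion is valid in the
new basis. -/
theorem repr_update {κ : Type*} [Fintype κ] [DecidableEq κ]
    (x x' : Module.Basis κ (Novikov K Γ) W) (z w : W) (j₀ : κ)
    (hx' : ⇑x' = Function.update x j₀ z) (hw : x.repr w j₀ = 0) (j : κ) :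
    x'.repr w j = x.repr w j := by
  have h1 : w = ∑ j, x.repr w j • x' j := by
    conv_lhs => rw [← x.sum_repr w]
    refine Finset.sum_congr rfl fun j _ => ?_
    by_cases hj : j = j₀
    · rw [hj, hw, zero_smul, zero_smul]
    · rw [hx', Function.update_of_ne hj]
  conv_lhs => rw [h1]
  rw [Module.Basis.repr_sum_self]

/-- Gaussian elimination by pivots of maximal size: orthogonal bases can be modified so that a
linear map becomes a partial matching of basis vectors. -/
theorem exists_matching_of_partial {ι κ : Type*} [Fintype ι] [Fintype κ] [DecidableEq ι]
    [DecidableEq κ] (hV : IsNonArchNormed K Γ ℓV) (hW : IsNonArchNormed K Γ ℓW)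
    (A : V →ₗ[Novikov K Γ] W) (N : ℕ) (y : Module.Basis ι (Novikov K Γ) V)
    (x : Module.Basis κ (Novikov K Γ) W) (P : Finset ι) (σ : ι → κ)
    (hy : Orthogonal (K := K) (Γ := Γ) ℓV y) (hx : Orthogonal (K := K) (Γ := Γ) ℓW x)
    (hσ : Set.InjOn σ P) (hP : ∀ i ∈ P, A (y i) = x (σ i))
    (hPc : ∀ i ∉ P, ∀ j ∈ P, x.repr (A (y i)) (σ j) = 0) (hN : Pᶜ.card = N) :
    ∃ (y : Module.Basis ι (Novikov K Γ) V) (x : Module.Basis κ (Novikov K Γ) W) (P : Finset ι)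
      (σ : ι → κ), Orthogonal (K := K) (Γ := Γ) ℓV y ∧ Orthogonal (K := K) (Γ := Γ) ℓW x ∧
      Set.InjOn σ P ∧ (∀ i ∈ P, A (y i) = x (σ i)) ∧ ∀ i ∉ P, A (y i) = 0 := by
  classical
  induction N generalizing y x P σ with
  | zero =>
    refine ⟨y, x, P, σ, hy, hx, hσ, hP, fun i hi => ?_⟩
    rw [Finset.card_eq_zero] at hN
    have : i ∈ Pᶜ := Finset.mem_compl.mpr hi
    simp [hN] at this
  | succ N ih =>
    by_cases hall : ∀ i ∉ P, A (y i) = 0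
    · exact ⟨y, x, P, σ, hy, hx, hσ, hP, hall⟩
    let Q : Finset (ι × κ) := Finset.univ.filter fun p => p.1 ∉ P ∧ x.repr (A (y p.1)) p.2 ≠ 0
    have hQ : Q.Nonempty := by
      push Not at hall
      obtain ⟨i, hi, hAi⟩ := hall
      have : x.repr (A (y i)) ≠ 0 := fun h => hAi (by simpa using h)
      obtain ⟨j, hj⟩ := Finsupp.ne_iff.mp this
      exact ⟨(i, j), Finset.mem_filter.mpr ⟨Finset.mem_univ _, hi, hj⟩⟩
    obtain ⟨⟨i₀, j₀⟩, h0, hmax⟩ := Finset.exists_max_image Q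
      (fun p => ℓW (x.repr (A (y p.1)) p.2 • x p.2) - ℓV (y p.1)) hQ
    obtain ⟨hi₀, hd⟩ := (Finset.mem_filter.mp h0).2
    simp only at hi₀ hd hmax
    have hmax' : ∀ i ∉ P, ∀ j, x.repr (A (y i)) j ≠ 0 →
        ℓW (x.repr (A (y i)) j • x j) - ℓV (y i) ≤
          ℓW (x.repr (A (y i₀)) j₀ • x j₀) - ℓV (y i₀) := fun i hi j hj =>
      hmax (i, j) (Finset.mem_filter.mpr ⟨Finset.mem_univ _, hi, hj⟩)
    -- By `hPc` the unmatched images have no component along matched targets, so the pivot cannot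
    -- land on one.
    have hj₀ : ∀ i ∈ P, σ i ≠ j₀ := fun i hi h => hd (h ▸ hPc i₀ hi₀ i hi)
    -- the new orthogonal basis of the target
    have hx'o : Orthogonal (K := K) (Γ := Γ) ℓW (Function.update x j₀ (A (y i₀))) := by
      refine hx.update hW _ _ fun j => ?_
      by_cases hj : x.repr (A (y i₀)) j = 0
      · rw [hj, zero_smul, hW.map_zero]; exact bot_le
      -- Maximality among the components of the pivot's own image.
      have h1 := hmax' i₀ hi₀ j hj
      have h2 := hW.eq_coe (smul_ne_zero hj (x.ne_zero j))
      have h3 := hW.eq_coe (smul_ne_zero hd (x.ne_zero j₀))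
      rw [hV.eq_coe (y.ne_zero i₀), h2, h3, ← EReal.coe_sub, ← EReal.coe_sub,
        EReal.coe_le_coe_iff] at h1
      rw [h2, h3, EReal.coe_le_coe_iff]
      linarith
    have hx'0 : ∀ j, Function.update x j₀ (A (y i₀)) j ≠ 0 := by
      intro j
      by_cases hj : j = j₀
      · subst hj
        rw [Function.update_self]
        intro h
        rw [h] at hd
        simp at hd
      · rw [Function.update_of_ne hj]; exact x.ne_zero j
    obtain ⟨x', hx'⟩ := hx'o.exists_basis hW hx'0 x
    rw [← hx'] at hx'o
    -- the new orthogonal basis of the source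
    let c : ι → Novikov K Γ := fun i =>
      if i ∈ P ∨ i = i₀ then 0 else x.repr (A (y i)) j₀ / x.repr (A (y i₀)) j₀
    have hc0 : c i₀ = 0 := if_pos (Or.inr rfl)
    have hc : ∀ i, ℓV (c i • y i₀) ≤ ℓV (y i) := by
      intro i
      by_cases hi : i ∈ P ∨ i = i₀
      · simp only [c, if_pos hi]
        rw [zero_smul, hV.map_zero]; exact bot_le
      · simp only [c, if_neg hi]
        push Not at hi
        -- Maximality among the $x_{j_0}$-components of the unmatched images.
        exact hV.div_smul_le hW hd (x.ne_zero j₀) (y.ne_zero i₀) (y.ne_zero i)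
          (hmax' i hi.1 j₀)
    have hy'o := hy.sub_multiples hV i₀ c hc0 hc
    have hy'0 : ∀ i, y i - c i • y i₀ ≠ 0 := by
      intro i h
      have h1 := congrArg (fun v => y.repr v i) h
      simp only [map_sub, map_smul, Module.Basis.repr_self, Finsupp.sub_apply, Finsupp.smul_apply,
        Finsupp.single_eq_same, map_zero, Finsupp.zero_apply, smul_eq_mul] at h1
      by_cases hi : i = i₀
      · subst hi; rw [hc0, zero_mul, sub_zero] at h1; exact one_ne_zero h1
      · rw [Finsupp.single_eq_of_ne hi, mul_zero, sub_zero] at h1; exact one_ne_zero h1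
    obtain ⟨y', hy'⟩ := hy'o.exists_basis hV hy'0 y
    rw [← hy'] at hy'o
    have hy'i : ∀ i, y' i = y i - c i • y i₀ := fun i => congrFun hy' i
    refine ih y' x' (insert i₀ P) (Function.update σ i₀ j₀) hy'o hx'o ?_ ?_ ?_ ?_
    · intro i hi j hj hij
      rw [Finset.mem_coe, Finset.mem_insert] at hi hj
      by_cases hi' : i = i₀ <;> by_cases hj' : j = i₀
      · rw [hi', hj']
      · rw [hi', Function.update_self, Function.update_of_ne hj'] at hij
        exact absurd hij.symm (hj₀ j (hj.resolve_left hj'))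
      · rw [hj', Function.update_self, Function.update_of_ne hi'] at hij
        exact absurd hij (hj₀ i (hi.resolve_left hi'))
      · rw [Function.update_of_ne hi', Function.update_of_ne hj'] at hij
        exact hσ (hi.resolve_left hi') (hj.resolve_left hj') hij
    · intro i hi
      rw [Finset.mem_insert] at hi
      have hci : c i = 0 := if_pos hi.symm
      rw [hy'i, hci, zero_smul, sub_zero, hx']
      by_cases hi' : i = i₀
      · rw [hi', Function.update_self, Function.update_self]
      · have := hi.resolve_left hi'
        rw [Function.update_of_ne hi', Function.update_of_ne (hj₀ i this), hP i this]
    · intro i hi j hj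
      rw [Finset.mem_insert, not_or] at hi
      have hci : c i = x.repr (A (y i)) j₀ / x.repr (A (y i₀)) j₀ :=
        if_neg (not_or.mpr ⟨hi.2, hi.1⟩)
      have hA : ∀ j, x.repr (A (y' i)) j = x.repr (A (y i)) j - c i * x.repr (A (y i₀)) j := by
        intro j
        rw [hy'i, map_sub, map_smul, map_sub, map_smul, Finsupp.sub_apply, Finsupp.smul_apply,
          smul_eq_mul]
      have hA0 : x.repr (A (y' i)) j₀ = 0 := by
        rw [hA, hci, div_mul_cancel₀ _ hd, sub_self]
      rw [repr_update x x' _ _ j₀ hx' hA0]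
      by_cases hj' : j = i₀
      · rw [hj', Function.update_self, hA0]
      · have hjP := (Finset.mem_insert.mp hj).resolve_left hj'
        rw [Function.update_of_ne hj', hA, hPc i hi.2 j hjP, hPc i₀ hi₀ j hjP, mul_zero, sub_zero]
    · rw [Finset.compl_insert, Finset.card_erase_of_mem (Finset.mem_compl.mpr hi₀), hN]; rfl

theorem exists_matching {ι κ : Type*} [Fintype ι] [Fintype κ]
    (hV : IsNonArchNormed K Γ ℓV) (hW : IsNonArchNormed K Γ ℓW)
    (A : V →ₗ[Novikov K Γ] W) (y : Module.Basis ι (Novikov K Γ) V)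
    (x : Module.Basis κ (Novikov K Γ) W)
    (hy : Orthogonal (K := K) (Γ := Γ) ℓV y) (hx : Orthogonal (K := K) (Γ := Γ) ℓW x) :
    ∃ (y : Module.Basis ι (Novikov K Γ) V) (x : Module.Basis κ (Novikov K Γ) W) (P : Finset ι)
      (σ : P → κ), Orthogonal (K := K) (Γ := Γ) ℓV y ∧ Orthogonal (K := K) (Γ := Γ) ℓW x ∧
      Function.Injective σ ∧ (∀ i : P, A (y i) = x (σ i)) ∧ ∀ i ∉ P, A (y i) = 0 := by
  classical
  -- The partial version uses a total $\sigma$, with irrelevant values off $P$; this needs a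
  -- nonempty target. If $W=0$, the empty matching works.
  rcases isEmpty_or_nonempty κ with hκ | hκ
  · have : Subsingleton W := x.repr.toEquiv.subsingleton
    exact ⟨y, x, ∅, fun i => (Finset.notMem_empty _ i.2).elim, hy, hx,
      fun i => (Finset.notMem_empty _ i.2).elim, fun i => (Finset.notMem_empty _ i.2).elim,
      fun i _ => Subsingleton.elim _ _⟩
  · obtain ⟨y, x, P, σ, hy, hx, hσ, hP, h0⟩ := exists_matching_of_partial hV hW A _ y x ∅
      (Classical.arbitrary (ι → κ)) hy hx (by simp) (by simp) (by simp) rfl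
    exact ⟨y, x, P, fun i => σ i, hy, hx, fun i j hij => Subtype.ext (hσ i.2 j.2 hij),
      fun i => hP i i.2, h0⟩

end Elimination

end FloerNovikov
namespace FloerNovikov

/-! ### Existence of singular value decompositions -/

section Existence

variable {K : Type u} [Field K] {Γ : AddSubgroup ℝ}
variable {V : Type v} [AddCommGroup V] [Module (Novikov K Γ) V] {ℓV : V → EReal}
variable {W : Type w} [AddCommGroup W] [Module (Novikov K Γ) W] {ℓW : W → EReal}

theorem Orthogonal.comp_injective {ι κ : Type*} [Fintype ι] [Fintype κ] {e : ι → V}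
    (he : Orthogonal (K := K) (Γ := Γ) ℓV e) {f : κ → ι} (hf : Function.Injective f) :
    Orthogonal (K := K) (Γ := Γ) ℓV (e ∘ f) := by
  classical
  intro c i
  have h1 := he (Function.extend f c 0) (f i)
  have h2 : ∑ j, Function.extend f c 0 j • e j = ∑ k, c k • e (f k) := by
    rw [← Finset.sum_subset (Finset.subset_univ (Finset.univ.image f)),
      Finset.sum_image fun a _ b _ h => hf h]
    · exact Finset.sum_congr rfl fun k _ => by rw [hf.extend_apply]
    · intro j _ hj
      have : ¬ ∃ a, f a = j := by simpa using hj
      rw [Function.extend_apply' _ _ _ this, Pi.zero_apply, zero_smul]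
  rw [hf.extend_apply, h2] at h1
  exact h1

theorem Orthogonal.of_map {ι : Type*} [Fintype ι] {e : ι → W} (f : W →ₗ[Novikov K Γ] V)
    (he : Orthogonal (K := K) (Γ := Γ) ℓV (f ∘ e)) :
    Orthogonal (K := K) (Γ := Γ) (fun w => ℓV (f w)) e := fun c i => by
  simpa using he c i

theorem map_eq_sum_of_matching {ι κ : Type*} [Fintype ι] [Fintype κ]
    {A : V →ₗ[Novikov K Γ] W} {y : Module.Basis ι (Novikov K Γ) V}
    {x : Module.Basis κ (Novikov K Γ) W} {P : Finset ι} {σ : P → κ}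
    (hP : ∀ i : P, A (y i) = x (σ i)) (h0 : ∀ i ∉ P, A (y i) = 0) (v : V) :
    A v = ∑ i : P, y.repr v i • x (σ i) := by
  classical
  conv_lhs => rw [← y.sum_repr v]
  rw [map_sum, ← Finset.sum_subset (Finset.subset_univ P), ← Finset.sum_coe_sort P]
  · exact Finset.sum_congr rfl fun i _ => by rw [map_smul, hP]
  · intro i _ hi
    rw [map_smul, h0 i hi, smul_zero]

/-- The kernel of a linear map between orthogonalizable spaces is orthogonalizable. -/
theorem IsOrthogonalizable.ker (hV : IsOrthogonalizable K Γ ℓV) (hW : IsOrthogonalizable K Γ ℓW)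
    (A : V →ₗ[Novikov K Γ] W) :
    IsOrthogonalizable K Γ (fun v : LinearMap.ker A => ℓV v) := by
  classical
  obtain ⟨hVn, n, y, hy⟩ := hV
  obtain ⟨hWn, m, x, hx⟩ := hW
  obtain ⟨y, x, P, σ, hy, hx, hσ, hP, h0⟩ :=
    exists_matching hVn hWn A y x hy.orthogonal hx.orthogonal
  have hn : IsNonArchNormed K Γ (fun v : LinearMap.ker A => ℓV v) :=
    hVn.comp_injective (LinearMap.ker A).subtype Subtype.val_injective
  refine ⟨hn, ?_⟩
  let e : {i // i ∉ P} → LinearMap.ker A := fun i => ⟨y i, h0 i i.2⟩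
  have hli : LinearIndependent (Novikov K Γ) e := by
    refine LinearIndependent.of_comp (LinearMap.ker A).subtype ?_
    exact y.linearIndependent.comp (fun i : {i // i ∉ P} => (i : Fin n)) Subtype.val_injective
  have hsp : ⊤ ≤ Submodule.span (Novikov K Γ) (Set.range e) := by
    rintro ⟨v, hv⟩ -
    -- The matched images are distinct basis vectors, so no nontrivial combination of matched $y_i$
    -- contributes zero.
    have h1 : ∀ i ∈ P, y.repr v i = 0 := by
      have h2 := map_eq_sum_of_matching hP h0 v
      rw [LinearMap.mem_ker.mp hv] at h2
      have h3 := Fintype.linearIndependent_iff.mp (x.linearIndependent.comp σ hσ)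
        (fun i => y.repr v i) h2.symm
      exact fun i hi => h3 ⟨i, hi⟩
    have h2 : v ∈ (Submodule.span (Novikov K Γ) (Set.range e)).map (LinearMap.ker A).subtype := by
      rw [Submodule.map_span, ← Set.range_comp, ← y.sum_repr v]
      refine Submodule.sum_mem _ fun i _ => ?_
      by_cases hi : i ∈ P
      · rw [h1 i hi, zero_smul]; exact Submodule.zero_mem _
      · exact Submodule.smul_mem _ _ (Submodule.subset_span ⟨⟨i, hi⟩, rfl⟩)
    obtain ⟨u, hu, huv⟩ := h2
    rwa [show (⟨v, hv⟩ : LinearMap.ker A) = u from Subtype.ext huv.symm]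
  have ho : Orthogonal (K := K) (Γ := Γ) (fun v : LinearMap.ker A => ℓV v) e :=
    Orthogonal.of_map (LinearMap.ker A).subtype
      (hy.comp_injective (f := fun i : {i // i ∉ P} => (i : Fin n)) Subtype.val_injective)
  let b := Module.Basis.mk hli hsp
  let E := (Fintype.equivFin {i // i ∉ P}).symm
  refine ⟨_, b.reindex E.symm, ?_⟩
  refine Orthogonal.isOrthogonal hn ?_
  have hb : ⇑(b.reindex E.symm) = e ∘ E := by
    ext i; simp [b]
  rw [hb]
  exact ho.reindex E

/-- Enumerating a type so that the elements of a subset come first, in a prescribed order. -/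
theorem exists_equiv_extending {ι : Type*} [Fintype ι] {r : ℕ} (f : Fin r → ι)
    (hf : Function.Injective f) :
    ∃ (p : ℕ) (E : Fin (r + p) ≃ ι), (∀ i, E (Fin.castAdd p i) = f i) ∧
      ∀ i j, E (Fin.natAdd r i) ≠ f j := by
  classical
  let e₂ := (Fintype.equivFin ((Set.range f)ᶜ : Set ι)).symm
  refine ⟨_, finSumFinEquiv.symm.trans (((Equiv.ofInjective f hf).sumCongr e₂).trans
    (Equiv.Set.sumCompl (Set.range f))), fun i => by simp, fun i j => ?_⟩
  have := (e₂ i).2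
  simp only [Equiv.trans_apply, finSumFinEquiv_symm_apply_natAdd, Equiv.sumCongr_apply,
    Sum.map_inr, Equiv.Set.sumCompl_apply_inr]
  exact fun h => this ⟨j, h.symm⟩

theorem exists_svd (hV : IsOrthogonalizable K Γ ℓV) (hW : IsOrthogonalizable K Γ ℓW)
    (A : V →ₗ[Novikov K Γ] W) : Nonempty (SVD ℓV ℓW A) := by
  classical
  obtain ⟨hVn, n, y, hy⟩ := hV
  obtain ⟨hWn, m, x, hx⟩ := hW
  obtain ⟨y, x, P, σ, hy, hx, hσ, hP, h0⟩ :=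
    exists_matching hVn hWn A y x hy.orthogonal hx.orthogonal
  have hrange : Submodule.span (Novikov K Γ) (Set.range (x ∘ σ)) = LinearMap.range A := by
    apply le_antisymm
    · rw [Submodule.span_le]
      rintro _ ⟨i, rfl⟩
      exact ⟨y i, hP i⟩
    · rintro _ ⟨v, rfl⟩
      rw [map_eq_sum_of_matching hP h0 v]
      exact Submodule.sum_mem _ fun i _ => Submodule.smul_mem _ _ (Submodule.subset_span ⟨i, rfl⟩)
  have hr : Module.finrank (Novikov K Γ) (LinearMap.range A) = Fintype.card P := by
    rw [← hrange, finrank_span_eq_card (x.linearIndependent.comp σ hσ)]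
  have hker : ∀ v, A v = 0 → ∀ i ∈ P, y.repr v i = 0 := fun v hv i hi => by
    have h2 := map_eq_sum_of_matching hP h0 v
    rw [hv] at h2
    exact Fintype.linearIndependent_iff.mp (x.linearIndependent.comp σ hσ)
      (fun i => y.repr v i) h2.symm ⟨i, hi⟩
  set r := Module.finrank (Novikov K Γ) (LinearMap.range A)
  let e₀ : Fin r ≃ P := (Fintype.equivFinOfCardEq hr.symm).symm
  -- The order dual turns the increasing sort into the required nonincreasing one.
  let d : Fin r → ERealᵒᵈ := fun i => OrderDual.toDual (ℓV (y (e₀ i)) - ℓW (x (σ (e₀ i))))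
  let e₁ : Fin r ≃ P := (Tuple.sort d).trans e₀
  have hsort : ∀ i j : Fin r, i ≤ j → ℓV (y (e₁ j)) - ℓW (x (σ (e₁ j))) ≤
      ℓV (y (e₁ i)) - ℓW (x (σ (e₁ i))) := fun i j hij => Tuple.monotone_sort d hij
  obtain ⟨p, E, hE, hE'⟩ := exists_equiv_extending (fun i => (e₁ i : Fin n))
    (Subtype.val_injective.comp e₁.injective)
  obtain ⟨q, F, hF, -⟩ := exists_equiv_extending (fun i => σ (e₁ i)) (hσ.comp e₁.injective)
  have hE₁ : ∀ (i : Fin (r + p)) (h : (i : ℕ) < r), E i = e₁ ⟨i, h⟩ := fun i h => hE ⟨i, h⟩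
  have hF₁ : ∀ (i : Fin (r + q)) (h : (i : ℕ) < r), F i = σ (e₁ ⟨i, h⟩) := fun i h => hF ⟨i, h⟩
  have hE₂ : ∀ i : Fin (r + p), r ≤ i → E i ∉ P := by
    intro i hi hP
    obtain ⟨j, rfl⟩ : ∃ j, i = Fin.natAdd r j := ⟨⟨i - r, by omega⟩, by ext; simp; omega⟩
    exact hE' j (e₁.symm ⟨_, hP⟩) (by simp)
  refine ⟨⟨r + p, r + q, y.reindex E.symm, x.reindex F.symm, ?_, ?_, ?_, ?_, ?_, ?_⟩⟩
  · refine Orthogonal.isOrthogonal hVn ?_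
    have : ⇑(y.reindex E.symm) = y ∘ E := by ext i; simp
    rw [this]; exact hy.reindex E
  · refine Orthogonal.isOrthogonal hWn ?_
    have : ⇑(x.reindex F.symm) = x ∘ F := by ext i; simp
    rw [this]; exact hx.reindex F
  · apply le_antisymm
    · rw [Submodule.span_le]
      rintro _ ⟨i, hi, rfl⟩
      simpa using h0 _ (hE₂ i hi)
    · intro v hv
      rw [← y.sum_repr v]
      refine Submodule.sum_mem _ fun i _ => ?_
      by_cases hi : i ∈ P
      · rw [hker v hv i hi, zero_smul]; exact Submodule.zero_mem _
      · refine Submodule.smul_mem _ _ (Submodule.subset_span ⟨E.symm i, ?_, by simp⟩)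
        by_contra hlt
        have := hE₁ (E.symm i) (not_le.mp hlt)
        rw [Equiv.apply_symm_apply] at this
        exact hi (this ▸ (e₁ _).2)
  · refine Eq.trans ?_ hrange
    congr 1
    ext z
    constructor
    · rintro ⟨i, hi, rfl⟩
      exact ⟨e₁ ⟨i, hi⟩, by simp [hF₁ i hi]⟩
    · rintro ⟨i, rfl⟩
      refine ⟨Fin.castAdd q (e₁.symm i), (e₁.symm i).2, ?_⟩
      simp [hF]
  · intro i j hij hi
    have hj : (j : ℕ) < r := hij ▸ hi
    simp only [Module.Basis.reindex_apply, Equiv.symm_symm]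
    rw [hE₁ i hi, hF₁ j hj, hP]
    simp only [hij]
  · intro i i' j j' hij hij' hle hi'
    have hi : (i : ℕ) < r := lt_of_le_of_lt hle hi'
    have hj : (j : ℕ) < r := hij ▸ hi
    have hj' : (j' : ℕ) < r := hij' ▸ hi'
    simp only [Module.Basis.reindex_apply, Equiv.symm_symm]
    rw [hE₁ i hi, hF₁ j hj, hE₁ i' hi', hF₁ j' hj']
    simp only [← hij, ← hij']
    exact hsort _ _ hle

theorem FilteredComplex.IsFloerType.nonempty_boundarySVD {C : FilteredComplex.{u, v} K Γ}
    (hC : C.IsFloerType) (k : ℤ) : Nonempty (C.BoundarySVD k) :=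
  exists_svd (hC.orthogonalizable (k + 1))
    ((hC.orthogonalizable k).ker (hC.orthogonalizable (k - 1)) (C.bd k (k - 1))) _

end Existence

end FloerNovikov
namespace FloerNovikov

/-! ### Independence of the barcode from the decomposition -/

section Uniqueness

variable {K : Type u} [Field K] {Γ : AddSubgroup ℝ}
variable {V : Type v} [AddCommGroup V] [Module (Novikov K Γ) V] {ℓV : V → EReal}
variable {W : Type w} [AddCommGroup W] [Module (Novikov K Γ) W] {ℓW : W → EReal}

theorem IsNonArchNormed.smul_le_iff (h : IsNonArchNormed K Γ ℓV) {y : V} (hy : y ≠ 0)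
    {c : Novikov K Γ} {s : ℝ} :
    ℓV (c • y) ≤ s ↔ ∀ g : Γ, coeffAt g c ≠ 0 → (ℓV y).toReal - s ≤ (g : ℝ) := by
  rw [h.smul, h.eq_coe hy, coe_sub_nu_le, EReal.toReal_coe]

theorem IsNonArchNormed.smul_lt_iff (h : IsNonArchNormed K Γ ℓV) {y : V} (hy : y ≠ 0)
    {c : Novikov K Γ} {s : ℝ} :
    ℓV (c • y) < s ↔ ∀ g : Γ, coeffAt g c ≠ 0 → (ℓV y).toReal - s < (g : ℝ) := by
  rw [h.smul, h.eq_coe hy, coe_sub_nu_lt, EReal.toReal_coe]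

theorem IsNonArchNormed.sum_lt (h : IsNonArchNormed K Γ ℓV) {ι : Type*} (s : Finset ι)
    (f : ι → V) {b : ℝ} (hb : ∀ i ∈ s, ℓV (f i) < b) : ℓV (∑ i ∈ s, f i) < b :=
  (h.sum_le s f fun _ hi => Finset.le_sup (f := fun i => ℓV (f i)) hi).trans_lt
    ((Finset.sup_lt_iff (EReal.bot_lt_coe b)).mpr hb)

theorem coeffAt_monomial_ne_zero {g h : Γ} {c : K}
    (hc : coeffAt h (monomial g c : Novikov K Γ) ≠ 0) : h = g := by
  by_contra hne
  exact hc (HahnSeries.coeff_single_of_ne hne)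

/-- Two descriptions of the same pair `N ⊆ M` by leading coefficients have the same number of
coefficients. -/
theorem card_le_of_leading_coeffs {ι κ : Type*} [Fintype ι] [Fintype κ]
    (x : Module.Basis ι (Novikov K Γ) W) (x' : Module.Basis κ (Novikov K Γ) W)
    (S : Finset ι) (S' : Finset κ) (g : ι → Γ) (g' : κ → Γ) (M N : Set W)
    (hM : ∀ f : S → K, ∑ i : S, monomial (g i) (f i) • x i ∈ M)
    (hN : ∀ w ∈ N, ∀ i ∈ S, coeffAt (g i) (x.repr w i) = 0)
    (hMN : ∀ w ∈ M, (∀ j ∈ S', coeffAt (g' j) (x'.repr w j) = 0) → w ∈ N) :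
    S.card ≤ S'.card := by
  classical
  -- This matrix sends $f$ to the primed leading coefficients of $\sum_i f_iT^{g_i}x_i$. If these
  -- all vanish, the element lies in $N$, so its unprimed leading coefficients, which are the $f_i$,
  -- vanish as well.
  let P : Matrix S' S K := fun j i => coeffAt (g' j - g i) (x'.repr (x i) j)
  have hP : ∀ (f : S → K) (j : S'), P.mulVec f j =
      coeffAt (g' j) (x'.repr (∑ i : S, monomial (g i) (f i) • x i) j) := by
    intro f j
    rw [map_sum, Finsupp.finsetSum_apply, coeffAt_sum]
    refine Finset.sum_congr rfl fun i _ => ?_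
    rw [map_smul, Finsupp.smul_apply, smul_eq_mul, coeffAt_monomial_mul, mul_comm]
  have hinj : Function.Injective P.mulVecLin := by
    rw [← LinearMap.ker_eq_bot, LinearMap.ker_eq_bot']
    intro f hf
    have h1 : ∑ i : S, monomial (g i) (f i) • x i ∈ N :=
      hMN _ (hM f) fun j hj => by rw [← hP f ⟨j, hj⟩]; exact congrFun hf ⟨j, hj⟩
    ext i
    have h2 := hN _ h1 i i.2
    have h3 : x.repr (∑ i : S, monomial (g i) (f i) • x i) i = monomial (g i) (f i) := by
      rw [map_sum, Finsupp.finsetSum_apply, Finset.sum_eq_single i]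
      · rw [map_smul, Finsupp.smul_apply, Module.Basis.repr_self, Finsupp.single_eq_same,
          smul_eq_mul, mul_one]
      · intro j _ hj
        rw [map_smul, Finsupp.smul_apply, Module.Basis.repr_self, Finsupp.single_eq_of_ne
          fun h => hj (Subtype.ext h.symm), smul_zero]
      · exact fun h => absurd (Finset.mem_univ i) h
    rw [h3, coeffAt_monomial_self] at h2
    exact h2
  have := LinearMap.finrank_le_finrank_of_injective hinj
  simpa using this

namespace SVD

variable {A : V →ₗ[Novikov K Γ] W}

/-- The rank of the map. -/
noncomputable abbrev rank (_ : SVD ℓV ℓW A) : ℕ := Module.finrank (Novikov K Γ) (LinearMap.range A)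

theorem rank_le_m (s : SVD ℓV ℓW A) : s.rank ≤ s.m := by
  have : Module.Finite (Novikov K Γ) W := Module.Finite.of_basis s.x
  have h := Submodule.finrank_le (LinearMap.range A)
  rwa [Module.finrank_eq_card_basis s.x, Fintype.card_fin] at h

theorem map_y (s : SVD ℓV ℓW A) (j : Fin s.m) (h : (j : ℕ) < s.rank) :
    A (s.y ⟨j, h.trans_le s.rank_le⟩) = s.x j :=
  s.map_eq _ _ rfl h

theorem map_y_of_le (s : SVD ℓV ℓW A) (i : Fin s.n) (h : s.rank ≤ i) : A (s.y i) = 0 := by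
  have : s.y i ∈ LinearMap.ker A := by
    rw [← s.span_ker]; exact Submodule.subset_span ⟨i, h, rfl⟩
  exact this

/-- In the two bases $A$ is an identity block bordered by zeros. Hence each coordinate of $Av$ with
index below the rank is bounded twice: through the $x_j$ by $\ell(Av)$, and through the $y_j$ by
$\ell(v)$. -/
theorem repr_map (s : SVD ℓV ℓW A) (v : V) (j : Fin s.m) :
    s.x.repr (A v) j =
      if h : (j : ℕ) < s.rank then s.y.repr v ⟨j, h.trans_le s.rank_le⟩ else 0 := by
  conv_lhs => rw [← s.y.sum_repr v]
  rw [map_sum, map_sum, Finsupp.finsetSum_apply]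
  have key : ∀ i : Fin s.n, i.val ≠ j.val ∨ ¬ i.val < s.rank → s.x.repr (A (s.y i)) j = 0 := by
    intro i hi
    by_cases hr : i.val < s.rank
    · have h1 := s.map_y ⟨i, hr.trans_le s.rank_le_m⟩ hr
      simp only [Fin.eta] at h1
      rw [h1, Module.Basis.repr_self, Finsupp.single_eq_of_ne]
      exact fun h => (hi.resolve_right (not_not.mpr hr)) (congrArg Fin.val h).symm
    · rw [s.map_y_of_le i (not_lt.mp hr), map_zero, Finsupp.zero_apply]
  by_cases h : (j : ℕ) < s.rank
  · rw [dif_pos h, Finset.sum_eq_single ⟨j, h.trans_le s.rank_le⟩]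
    · rw [map_smul, map_smul, Finsupp.smul_apply, s.map_y j h, Module.Basis.repr_self,
        Finsupp.single_eq_same, smul_eq_mul, mul_one]
    · intro i _ hi
      rw [map_smul, map_smul, Finsupp.smul_apply,
        key i (Or.inl fun h => hi (Fin.ext h)), smul_zero]
    · exact fun h => absurd (Finset.mem_univ _) h
  · rw [dif_neg h]
    refine Finset.sum_eq_zero fun i _ => ?_
    rw [map_smul, map_smul, Finsupp.smul_apply, key i, smul_zero]
    by_cases hij : i.val = j.val
    · exact Or.inr (hij ▸ h)
    · exact Or.inl hij

/-- The standard preimage of the combination of the `x_i`, `i < r`, with coefficients `c_i`. -/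
noncomputable def lift (s : SVD ℓV ℓW A) (c : Fin s.m → Novikov K Γ) : V :=
  ∑ j : Fin s.m, if h : (j : ℕ) < s.rank then c j • s.y ⟨j, h.trans_le s.rank_le⟩ else 0

theorem map_lift (s : SVD ℓV ℓW A) (c : Fin s.m → Novikov K Γ) :
    A (s.lift c) = ∑ j : Fin s.m, if (j : ℕ) < s.rank then c j • s.x j else 0 := by
  rw [lift, map_sum]
  refine Finset.sum_congr rfl fun j _ => ?_
  by_cases h : (j : ℕ) < s.rank
  · rw [dif_pos h, if_pos h, map_smul, s.map_y j h]
  · rw [dif_neg h, if_neg h, map_zero]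

/-- The bar of index `i`. -/
noncomputable def bar (s : SVD ℓV ℓW A) (i : Fin s.m) : (ℝ ⧸ Γ) × ℝ≥0∞ :=
  (((ℓW (s.x i)).toReal : ℝ ⧸ Γ),
    if h : (i : ℕ) < s.rank then
      (ℓV (s.y ⟨i, h.trans_le s.rank_le⟩) - ℓW (s.x i)).toENNReal
    else ⊤)

theorem bars_eq (s : SVD ℓV ℓW A) : s.bars = Finset.univ.val.map s.bar := rfl

theorem le_y (s : SVD ℓV ℓW A) (hV : IsNonArchNormed K Γ ℓV) (hW : IsNonArchNormed K Γ ℓW)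
    (hA : ∀ v, ℓW (A v) ≤ ℓV v) (j : Fin s.m) (h : (j : ℕ) < s.rank) :
    (ℓW (s.x j)).toReal ≤ (ℓV (s.y ⟨j, h.trans_le s.rank_le⟩)).toReal := by
  have := hA (s.y ⟨j, h.trans_le s.rank_le⟩)
  rwa [s.map_y j h, hV.eq_coe (s.y.ne_zero _), hW.eq_coe (s.x.ne_zero _),
    EReal.coe_le_coe_iff] at this

theorem bar_snd_of_lt (s : SVD ℓV ℓW A) (hV : IsNonArchNormed K Γ ℓV)
    (hW : IsNonArchNormed K Γ ℓW) (j : Fin s.m) (h : (j : ℕ) < s.rank) :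
    (s.bar j).2 = ENNReal.ofReal
      ((ℓV (s.y ⟨j, h.trans_le s.rank_le⟩)).toReal - (ℓW (s.x j)).toReal) := by
  have h1 : (s.bar j).2 = (ℓV (s.y ⟨j, h.trans_le s.rank_le⟩) - ℓW (s.x j)).toENNReal := dif_pos h
  rw [h1, hV.eq_coe (s.y.ne_zero _), hW.eq_coe (s.x.ne_zero _), ← EReal.coe_sub,
    EReal.toENNReal_of_ne_top (EReal.coe_ne_top _)]
  simp only [EReal.toReal_coe]

theorem bar_snd_of_not_lt (s : SVD ℓV ℓW A) (j : Fin s.m) (h : ¬ (j : ℕ) < s.rank) :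
    (s.bar j).2 = ⊤ := dif_neg h

theorem bar_eq_iff_of_top (s : SVD ℓV ℓW A) (hV : IsNonArchNormed K Γ ℓV)
    (hW : IsNonArchNormed K Γ ℓW) (j : Fin s.m) (a : ℝ) :
    s.bar j = ((a : ℝ ⧸ Γ), ⊤) ↔ ¬ (j : ℕ) < s.rank ∧ (ℓW (s.x j)).toReal - a ∈ Γ := by
  have h1 : (s.bar j).1 = (a : ℝ ⧸ Γ) ↔ (ℓW (s.x j)).toReal - a ∈ Γ := by
    rw [← neg_mem_iff, neg_sub, sub_eq_neg_add]; exact QuotientAddGroup.eq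
  rw [Prod.ext_iff, h1, and_comm]
  refine and_congr_left fun _ => ⟨fun h hlt => ?_, s.bar_snd_of_not_lt j⟩
  rw [s.bar_snd_of_lt hV hW j hlt] at h
  exact ENNReal.ofReal_ne_top h

theorem bar_eq_iff_of_ne_top (s : SVD ℓV ℓW A) (hV : IsNonArchNormed K Γ ℓV)
    (hW : IsNonArchNormed K Γ ℓW) (hA : ∀ v, ℓW (A v) ≤ ℓV v) (j : Fin s.m) (a : ℝ) {L : ℝ≥0∞}
    (hL : L ≠ ⊤) :
    s.bar j = ((a : ℝ ⧸ Γ), L) ↔ (ℓW (s.x j)).toReal - a ∈ Γ ∧ ∃ h : (j : ℕ) < s.rank,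
      (ℓV (s.y ⟨j, h.trans_le s.rank_le⟩)).toReal = (ℓW (s.x j)).toReal + L.toReal := by
  have h1 : (s.bar j).1 = (a : ℝ ⧸ Γ) ↔ (ℓW (s.x j)).toReal - a ∈ Γ := by
    rw [← neg_mem_iff, neg_sub, sub_eq_neg_add]; exact QuotientAddGroup.eq
  rw [Prod.ext_iff, h1]
  refine and_congr_right fun _ => ⟨fun h => ?_, fun ⟨hlt, h⟩ => ?_⟩
  · by_cases hlt : (j : ℕ) < s.rank
    · refine ⟨hlt, ?_⟩
      rw [s.bar_snd_of_lt hV hW j hlt] at h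
      have h2 := congrArg ENNReal.toReal h
      -- `ENNReal.ofReal` truncates negative numbers to $0$; the inequality $\ell(Av)\le\ell(v)$
      -- ensures that nothing is lost.
      rw [ENNReal.toReal_ofReal (sub_nonneg.mpr (s.le_y hV hW hA j hlt))] at h2
      simp only at h2
      linarith
    · rw [s.bar_snd_of_not_lt j hlt] at h; exact absurd h.symm hL
  · rw [s.bar_snd_of_lt hV hW j hlt, h, add_sub_cancel_left, ENNReal.ofReal_toReal hL]

open Classical in
/-- The exponent `ℓ(x_i) - a`, if it lies in `Γ`. -/
noncomputable def exponent (s : SVD ℓV ℓW A) (a : ℝ) (i : Fin s.m) : Γ :=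
  if h : (ℓW (s.x i)).toReal - a ∈ Γ then ⟨_, h⟩ else 0

theorem coe_exponent (s : SVD ℓV ℓW A) {a : ℝ} {i : Fin s.m}
    (h : (ℓW (s.x i)).toReal - a ∈ Γ) : (s.exponent a i : ℝ) = (ℓW (s.x i)).toReal - a := by
  rw [exponent, dif_pos h]

theorem sum_smul_x_le (s : SVD ℓV ℓW A) (hW : IsNonArchNormed K Γ ℓW) (a : ℝ)
    (S : Finset (Fin s.m)) (hS : ∀ i ∈ S, (ℓW (s.x i)).toReal - a ∈ Γ) (f : S → K) :
    ℓW (∑ i : S, monomial (s.exponent a i) (f i) • s.x i) ≤ a := by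
  refine hW.sum_le _ _ fun i _ => (hW.smul_le_iff (s.x.ne_zero _)).mpr fun g hg => ?_
  rw [coeffAt_monomial_ne_zero hg, s.coe_exponent (hS i i.2)]

/-- A nonzero coefficient at this exponent would give the $x_i$-component level at least $a$,
whereas orthogonality bounds it by $\ell(w)<a$. -/
theorem coeffAt_repr_eq_zero (s : SVD ℓV ℓW A) (hW : IsNonArchNormed K Γ ℓW) {a : ℝ}
    {i : Fin s.m} (hi : (ℓW (s.x i)).toReal - a ∈ Γ) {w : W} (hw : ℓW w < a) :
    coeffAt (s.exponent a i) (s.x.repr w i) = 0 := by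
  by_contra h
  have h1 := (hW.smul_lt_iff (s.x.ne_zero i)).mp
    ((s.orthogonal_x.orthogonal.repr_le w i).trans_lt hw) _ h
  rw [s.coe_exponent hi] at h1
  exact lt_irrefl _ h1

theorem sub_map_lift (s : SVD ℓV ℓW A) (w : W) (c : Fin s.m → Novikov K Γ) :
    w - A (s.lift c) =
      ∑ j : Fin s.m, (s.x.repr w j - if (j : ℕ) < s.rank then c j else 0) • s.x j := by
  conv_lhs => rw [← s.x.sum_repr w]
  rw [map_lift, ← Finset.sum_sub_distrib]
  refine Finset.sum_congr rfl fun j _ => ?_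
  split_ifs
  · rw [sub_smul]
  · rw [sub_zero, sub_zero]

/-- Modulo the image and levels below $a$, an element of level at most $a$ is determined by its
coefficients at $T^{\ell(x_i)-a}$ for the infinite bars of class $[a]$. -/
theorem card_bar_le_of_top (s t : SVD ℓV ℓW A) (hV : IsNonArchNormed K Γ ℓV)
    (hW : IsNonArchNormed K Γ ℓW) (a : ℝ) (S : Finset (Fin s.m)) (S' : Finset (Fin t.m))
    (hS : ∀ i, i ∈ S ↔ s.bar i = ((a : ℝ ⧸ Γ), ⊤))
    (hS' : ∀ i, i ∈ S' ↔ t.bar i = ((a : ℝ ⧸ Γ), ⊤)) :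
    S.card ≤ S'.card := by
  simp only [bar_eq_iff_of_top _ hV hW] at hS hS'
  refine card_le_of_leading_coeffs s.x t.x S S' (s.exponent a) (t.exponent a) {w | ℓW w ≤ a}
    {w | ∃ v, ℓW (w - A v) < a} (s.sum_smul_x_le hW a S fun i hi => ((hS i).mp hi).2) ?_ ?_
  · rintro w ⟨v, hv⟩ i hi
    rw [hS] at hi
    have h1 := s.coeffAt_repr_eq_zero hW hi.2 hv
    rwa [map_sub, Finsupp.sub_apply, s.repr_map, dif_neg hi.1, sub_zero] at h1
  · intro w hw h0
    -- Subtracting this image cancels all components with index below the rank.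
    refine ⟨t.lift (t.x.repr w), ?_⟩
    rw [sub_map_lift]
    refine hW.sum_lt _ _ fun j _ => ?_
    split_ifs with hj
    · rw [sub_self, zero_smul, hW.map_zero]; exact EReal.bot_lt_coe a
    · rw [sub_zero, hW.smul_lt_iff (t.x.ne_zero j)]
      intro g hg
      have h1 := (hW.smul_le_iff (t.x.ne_zero j)).mp
        ((t.orthogonal_x.orthogonal.repr_le w j).trans hw) g hg
      refine lt_of_le_of_ne h1 fun heq => ?_
      have h2 : (ℓW (t.x j)).toReal - a ∈ Γ := heq ▸ g.2
      have h3 : t.exponent a j = g := Subtype.ext ((t.coe_exponent h2).trans heq)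
      exact hg (h3 ▸ h0 j ((hS' j).mpr ⟨hj, h2⟩))

/-- Bars of length other than $L$ do not survive in the quotient: a shorter bar has a preimage of
level below $a+L$, and for a longer one the preimage bound already forces the image below $a$. -/
theorem card_bar_le_of_ne_top (s t : SVD ℓV ℓW A) (hV : IsNonArchNormed K Γ ℓV)
    (hW : IsNonArchNormed K Γ ℓW) (hA : ∀ v, ℓW (A v) ≤ ℓV v) (a : ℝ) {L : ℝ≥0∞} (hL : L ≠ ⊤)
    (S : Finset (Fin s.m)) (S' : Finset (Fin t.m))
    (hS : ∀ i, i ∈ S ↔ s.bar i = ((a : ℝ ⧸ Γ), L))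
    (hS' : ∀ i, i ∈ S' ↔ t.bar i = ((a : ℝ ⧸ Γ), L)) :
    S.card ≤ S'.card := by
  classical
  simp only [bar_eq_iff_of_ne_top _ hV hW hA _ _ hL] at hS hS'
  refine card_le_of_leading_coeffs s.x t.x S S' (s.exponent a) (t.exponent a)
    {w | ℓW w ≤ a ∧ ∃ v, A v = w ∧ ℓV v ≤ (a + L.toReal : ℝ)}
    {w | ∃ v, ℓV v < (a + L.toReal : ℝ) ∧ ℓW (w - A v) < a} ?_ ?_ ?_
  · intro f
    refine ⟨s.sum_smul_x_le hW a S (fun i hi => ((hS i).mp hi).1) f,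
      s.lift (fun i => if h : i ∈ S then monomial (s.exponent a i) (f ⟨i, h⟩) else 0), ?_, ?_⟩
    · rw [map_lift, ← Finset.sum_subset (Finset.subset_univ S), ← Finset.sum_coe_sort S]
      · refine Finset.sum_congr rfl fun i _ => ?_
        obtain ⟨-, hlt, -⟩ := (hS i).mp i.2
        rw [if_pos hlt, dif_pos i.2]
      · intro i _ hi
        rw [dif_neg hi, zero_smul, ite_self]
    · refine hV.sum_le _ _ fun i _ => ?_
      by_cases hlt : (i : ℕ) < s.rank
      swap
      · rw [dif_neg hlt, hV.map_zero]; exact bot_le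
      by_cases hi : i ∈ S
      swap
      · simp only [dif_pos hlt, dif_neg hi, zero_smul, hV.map_zero]; exact bot_le
      obtain ⟨hΓ, _, he⟩ := (hS i).mp hi
      simp only [dif_pos hlt, dif_pos hi]
      rw [hV.smul_le_iff (s.y.ne_zero _)]
      intro g hg
      rw [coeffAt_monomial_ne_zero hg, s.coe_exponent hΓ, he]
      linarith
  · rintro w ⟨v, hv, hwv⟩ i hi
    obtain ⟨hΓ, hlt, he⟩ := (hS i).mp hi
    have h1 := s.coeffAt_repr_eq_zero hW hΓ hwv
    have h2 : coeffAt (s.exponent a i) (s.x.repr (A v) i) = 0 := by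
      rw [s.repr_map, dif_pos hlt]
      by_contra h
      have h1 := (hV.smul_lt_iff (s.y.ne_zero _)).mp
        ((s.orthogonal_y.orthogonal.repr_le v _).trans_lt hv) _ h
      rw [s.coe_exponent hΓ, he] at h1
      linarith
    rw [← sub_add_cancel w (A v), map_add, Finsupp.add_apply, coeffAt_add, h1, h2, add_zero]
  · rintro w ⟨hw, v, rfl, hv⟩ h0
    have hq : ∀ (j : Fin t.m) (g : Γ), coeffAt g (t.x.repr (A v) j) ≠ 0 →
        (ℓW (t.x j)).toReal - a ≤ g := fun j =>
      (hW.smul_le_iff (t.x.ne_zero j)).mp ((t.orthogonal_x.orthogonal.repr_le _ j).trans hw)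
    have hp : ∀ (j : Fin t.m) (hj : (j : ℕ) < t.rank) (g : Γ), coeffAt g (t.x.repr (A v) j) ≠ 0 →
        (ℓV (t.y ⟨j, hj.trans_le t.rank_le⟩)).toReal - (a + L.toReal) ≤ g := fun j hj => by
      rw [t.repr_map, dif_pos hj]
      exact (hV.smul_le_iff (t.y.ne_zero _)).mp ((t.orthogonal_y.orthogonal.repr_le _ _).trans hv)
    -- $Q_j$ says that the bar has length at most $L$. Those components are put into the preimage
    -- and the longer ones are left in the remainder.
    let Q : Fin t.m → Prop := fun j => ∃ hj : (j : ℕ) < t.rank,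
      (ℓV (t.y ⟨j, hj.trans_le t.rank_le⟩)).toReal - (a + L.toReal) ≤ (ℓW (t.x j)).toReal - a
    refine ⟨t.lift fun j => if Q j then t.x.repr (A v) j else 0, ?_, ?_⟩
    · refine hV.sum_lt _ _ fun j _ => ?_
      by_cases hj : (j : ℕ) < t.rank
      swap
      · simp only [dif_neg hj, hV.map_zero]; exact EReal.bot_lt_coe _
      by_cases hQ : Q j
      · simp only [dif_pos hj, if_pos hQ]
        obtain ⟨_, hQ⟩ := hQ
        rw [hV.smul_lt_iff (t.y.ne_zero _)]
        intro g hg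
        -- Equality would make both bounds on the exponent sharp, so the bar would be $([a],L)$ and
        -- the coefficient one that `h0` kills.
        refine lt_of_le_of_ne (hp j hj g hg) fun heq => ?_
        have h1 := hq j g hg
        have h2 : (ℓW (t.x j)).toReal - a = g := le_antisymm h1 (heq ▸ hQ)
        have h3 : (ℓW (t.x j)).toReal - a ∈ Γ := h2 ▸ g.2
        have h4 : t.exponent a j = g := Subtype.ext ((t.coe_exponent h3).trans h2)
        exact hg (h4 ▸ h0 j ((hS' j).mpr ⟨h3, hj, by linarith⟩))
      · simp only [dif_pos hj, if_neg hQ, zero_smul, hV.map_zero]; exact EReal.bot_lt_coe _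
    · rw [sub_map_lift]
      refine hW.sum_lt _ _ fun j _ => ?_
      by_cases hj : (j : ℕ) < t.rank
      · rw [if_pos hj]
        by_cases hQ : Q j
        · rw [if_pos hQ, sub_self, zero_smul, hW.map_zero]; exact EReal.bot_lt_coe a
        · rw [if_neg hQ, sub_zero, hW.smul_lt_iff (t.x.ne_zero j)]
          intro g hg
          have h1 := hp j hj g hg
          have h2 := fun h => hQ ⟨hj, h⟩
          linarith [not_le.mp h2]
      · rw [if_neg hj, sub_zero, t.repr_map, dif_neg hj, zero_smul, hW.map_zero]
        exact EReal.bot_lt_coe a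

/-- The barcode does not depend on the singular value decomposition. -/
theorem bars_unique (hV : IsNonArchNormed K Γ ℓV)
    (hW : IsNonArchNormed K Γ ℓW) (hA : ∀ v, ℓW (A v) ≤ ℓV v) (s t : SVD ℓV ℓW A) :
    s.bars = t.bars := by
  classical
  have key : ∀ (s t : SVD ℓV ℓW A) (b : (ℝ ⧸ Γ) × ℝ≥0∞),
      s.bars.count b ≤ t.bars.count b := by
    rintro s t ⟨q, L⟩
    obtain ⟨a, rfl⟩ := QuotientAddGroup.mk_surjective q
    have hc : ∀ s : SVD ℓV ℓW A, s.bars.count ((a : ℝ ⧸ Γ), L) =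
        (Finset.univ.filter fun i => s.bar i = ((a : ℝ ⧸ Γ), L)).card := fun s => by
      rw [bars_eq, Multiset.count_map]
      simp only [eq_comm]
      rfl
    refine (hc s).trans_le (le_trans ?_ (hc t).ge)
    by_cases hL : L = ⊤
    · subst hL
      exact card_bar_le_of_top s t hV hW a _ _ (by simp) (by simp)
    · exact card_bar_le_of_ne_top s t hV hW hA a hL _ _ (by simp) (by simp)
  exact Multiset.ext.mpr fun b => le_antisymm (key s t b) (key t s b)

end SVD

end Uniqueness

end FloerNovikov
namespace FloerNovikov

theorem coe_sum_smul {R M ι : Type*} [Semiring R] [AddCommMonoid M] [Module R M] [Fintype ι]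
    (p : Submodule R M) (x : ι → p) (c : ι → R) :
    ((∑ i, c i • x i : p) : M) = ∑ i, c i • (x i : M) := by
  simp

/-! ### Rescaling to prescribed filtration levels -/

section Normalization

variable {K : Type u} [Field K] {Γ : AddSubgroup ℝ}
variable {V : Type v} [AddCommGroup V] [Module (Novikov K Γ) V] {ℓV : V → EReal}
variable {W : Type w} [AddCommGroup W] [Module (Novikov K Γ) W] {ℓW : W → EReal}

/-- Equal multiplicities give bijections between the fibres over each value, which glue. -/
theorem exists_equiv_of_map_univ_eq {ι κ β : Type*} [Fintype ι] [Fintype κ] (f : ι → β)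
    (g : κ → β) (h : Finset.univ.val.map f = Finset.univ.val.map g) :
    ∃ e : ι ≃ κ, ∀ i, g (e i) = f i := by
  classical
  have key : ∀ b, Nonempty ({i // f i = b} ≃ {j // g j = b}) := fun b => by
    refine Fintype.card_eq.mp ?_
    have h1 := congrArg (Multiset.count b) h
    rw [Multiset.count_map, Multiset.count_map] at h1
    rw [Fintype.card_subtype, Fintype.card_subtype]
    simp only [eq_comm (b := b)]
    exact h1
  exact ⟨Equiv.ofFiberEquiv fun b => (key b).some, fun i => Equiv.ofFiberEquiv_map _ i⟩

theorem Orthogonal.smul {ι : Type*} [Fintype ι] {e : ι → V}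
    (he : Orthogonal (K := K) (Γ := Γ) ℓV e) (μ : ι → Novikov K Γ) :
    Orthogonal (K := K) (Γ := Γ) ℓV (fun i => μ i • e i) := fun c i => by
  have := he (fun i => c i * μ i) i
  simpa only [mul_smul] using this

namespace SVD

variable {A : V →ₗ[Novikov K Γ] W}

/-- Applying $A$ shows that the $y_j$-coordinate of $z+\sum c_iy_i$ is $c_j$, since the cycle $z$
contributes nothing; orthogonality of the $y$'s then applies. -/
theorem smul_y_le (s : SVD ℓV ℓW A) (z : V) (hz : A z = 0) (c : Fin s.m → Novikov K Γ)
    (j : Fin s.m) (hj : (j : ℕ) < s.rank) :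
    ℓV (c j • s.y ⟨j, hj.trans_le s.rank_le⟩) ≤ ℓV (z + s.lift c) := by
  have h1 := s.repr_map (z + s.lift c) j
  rw [dif_pos hj, map_add, hz, zero_add, map_lift] at h1
  have h2 : (∑ j : Fin s.m, if (j : ℕ) < s.rank then c j • s.x j else 0) =
      ∑ j : Fin s.m, (if (j : ℕ) < s.rank then c j else 0) • s.x j :=
    Finset.sum_congr rfl fun j _ => by rw [ite_smul, zero_smul]
  rw [h2, Module.Basis.repr_sum_self, if_pos hj] at h1
  rw [h1]
  exact s.orthogonal_y.orthogonal.repr_le _ _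

theorem map_sub_lift_repr (s : SVD ℓV ℓW A) (v : V) :
    A (v - s.lift (s.x.repr (A v))) = 0 := by
  rw [map_sub, sub_map_lift]
  refine Finset.sum_eq_zero fun j _ => ?_
  by_cases hj : (j : ℕ) < s.rank
  · rw [if_pos hj, sub_self, zero_smul]
  · rw [if_neg hj, s.repr_map, dif_neg hj, sub_zero, zero_smul]

/-- A singular value decomposition can be rescaled so that the filtration levels are prescribed
representatives. -/
theorem exists_rescaling (s : SVD ℓV ℓW A) (hV : IsNonArchNormed K Γ ℓV)
    (hW : IsNonArchNormed K Γ ℓW) (hA : ∀ v, ℓW (A v) ≤ ℓV v) {n : ℕ} (a : Fin n → ℝ)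
    (L : Fin n → ℝ≥0∞)
    (h : Finset.univ.val.map (fun i => ((a i : ℝ ⧸ Γ), L i)) = s.bars) :
    ∃ (x : Fin n → W) (y : Fin n → V),
      (∀ c : Fin n → Novikov K Γ, ℓW (∑ i, c i • x i) =
        Finset.univ.sup fun i => (a i : EReal) - nu (c i)) ∧
      (∀ w, ∃ c : Fin n → Novikov K Γ, w = ∑ i, c i • x i) ∧
      (∀ i, L i = ⊤ → y i = 0) ∧ (∀ i, L i ≠ ⊤ → A (y i) = x i) ∧
      (∀ z, A z = 0 → ∀ c : Fin n → Novikov K Γ, (∀ i, L i = ⊤ → c i = 0) →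
        ℓV (z + ∑ i, c i • y i) =
          max (ℓV z) (Finset.univ.sup fun i => ((a i : EReal) + (L i : EReal)) - nu (c i))) ∧
      ∀ v, ∃ (z : V) (c : Fin n → Novikov K Γ), A z = 0 ∧ v = z + ∑ i, c i • y i := by
  obtain ⟨e, he⟩ := exists_equiv_of_map_univ_eq _ _ (h.trans s.bars_eq)
  have hΓ : ∀ i, (ℓW (s.x (e i))).toReal - a i ∈ Γ := fun i => by
    have h1 := he i
    by_cases hL : L i = ⊤
    · rw [hL] at h1; exact ((s.bar_eq_iff_of_top hV hW _ _).mp h1).2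
    · exact ((s.bar_eq_iff_of_ne_top hV hW hA _ _ hL).mp h1).1
  have htop : ∀ i, L i = ⊤ ↔ ¬ (e i : ℕ) < s.rank := fun i => by
    have h1 := he i
    by_cases hL : L i = ⊤
    · rw [hL] at h1; exact iff_of_true hL ((s.bar_eq_iff_of_top hV hW _ _).mp h1).1
    · obtain ⟨h2, -⟩ := ((s.bar_eq_iff_of_ne_top hV hW hA _ _ hL).mp h1).2
      exact iff_of_false hL (not_not.mpr h2)
  -- The monomial $T^{\ell(x)-a_i}$ lowers the level of $x$ to $a_i$. Applied to $y$ as well, it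
  -- preserves both $\partial y=x$ and the bar length.
  let μ : Fin n → Novikov K Γ := fun i => monomial (s.exponent (a i) (e i)) 1
  have hμ0 : ∀ i, μ i ≠ 0 := fun i => monomial_ne_zero _
  have hμ : ∀ i, nu (μ i) = (((ℓW (s.x (e i))).toReal - a i : ℝ) : EReal) := fun i => by
    rw [← s.coe_exponent (hΓ i)]; exact nu_monomial _
  let y : Fin n → V := fun i =>
    if hi : (e i : ℕ) < s.rank then μ i • s.y ⟨e i, hi.trans_le s.rank_le⟩ else 0
  have hlift : ∀ c : Fin n → Novikov K Γ,
      ∑ i, c i • y i = s.lift fun j => c (e.symm j) * μ (e.symm j) := fun c => by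
    rw [lift, ← Equiv.sum_comp e]
    refine Finset.sum_congr rfl fun i _ => ?_
    by_cases hi : (e i : ℕ) < s.rank
    · simp only [y, dif_pos hi, Equiv.symm_apply_apply, mul_smul]
    · simp only [y, dif_neg hi, smul_zero]
  have hℓy : ∀ (c : Novikov K Γ) (i : Fin n), L i ≠ ⊤ →
      ℓV (c • y i) = ((a i : EReal) + (L i : EReal)) - nu c := fun c i hL => by
    obtain ⟨hlt, h2⟩ := ((s.bar_eq_iff_of_ne_top hV hW hA _ _ hL).mp (he i)).2
    simp only [y, dif_pos hlt]
    rw [hV.smul, hV.smul, hμ, hV.eq_coe (s.y.ne_zero _), h2, ← EReal.coe_sub,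
      ← EReal.coe_ennreal_toReal hL, ← EReal.coe_add]
    congr 2
    ring
  refine ⟨fun i => μ i • s.x (e i), y, ?_, ?_, ?_, ?_, ?_, ?_⟩
  · intro c
    refine (((s.orthogonal_x.orthogonal.reindex e).smul μ).eq_sup hW c).trans ?_
    congr 1
    ext i
    simp only [Function.comp_apply]
    rw [hW.smul, hW.smul, hμ, hW.eq_coe (s.x.ne_zero _), ← EReal.coe_sub, EReal.toReal_coe,
      sub_sub_cancel]
  · intro w
    refine ⟨fun i => s.x.repr w (e i) * (μ i)⁻¹, ?_⟩
    conv_lhs => rw [← s.x.sum_repr w, ← Equiv.sum_comp e]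
    refine Finset.sum_congr rfl fun i _ => ?_
    rw [smul_smul, mul_assoc, inv_mul_cancel₀ (hμ0 i), mul_one]
  · intro i hi
    exact dif_neg ((htop i).mp hi)
  · intro i hi
    have hlt : (e i : ℕ) < s.rank := not_not.mp fun h => hi ((htop i).mpr h)
    simp only [y, dif_pos hlt]
    rw [map_smul, s.map_y _ hlt]
  · intro z hz c hc
    have hle : ∀ i, ℓV (c i • y i) ≤ ℓV (z + ∑ i, c i • y i) := fun i => by
      by_cases hi : (e i : ℕ) < s.rank
      · have h1 := s.smul_y_le z hz (fun j => c (e.symm j) * μ (e.symm j)) (e i) hi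
        rw [← hlift] at h1
        simpa only [y, dif_pos hi, Equiv.symm_apply_apply, mul_smul] using h1
      · simp only [y, dif_neg hi, smul_zero, hV.map_zero]; exact bot_le
    have hval : ∀ i, ℓV (c i • y i) = ((a i : EReal) + (L i : EReal)) - nu (c i) := fun i => by
      by_cases hL : L i = ⊤
      -- On an infinite bar the right side is $\infty-\infty$, which `EReal` evaluates to $-\infty$,
      -- as needed for a zero term.
      · rw [hc i hL, zero_smul, hV.map_zero, nu_zero]; simp
      · exact hℓy _ _ hL
    simp only [← hval]
    apply le_antisymm
    · exact (hV.add_le _ _).trans (max_le_max le_rfl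
        (hV.sum_le _ _ fun _ hi => Finset.le_sup (f := fun i => ℓV (c i • y i)) hi))
    · refine max_le ?_ (Finset.sup_le fun i _ => hle i)
      conv_lhs => rw [← add_sub_cancel_right z (∑ i, c i • y i)]
      exact (hV.sub_le _ _).trans (max_le le_rfl (hV.sum_le _ _ fun i _ => hle i))
  · intro v
    refine ⟨v - s.lift (s.x.repr (A v)), fun i => s.x.repr (A v) (e i) * (μ i)⁻¹,
      s.map_sub_lift_repr v, ?_⟩
    rw [hlift]
    have : (fun j => s.x.repr (A v) (e (e.symm j)) * (μ (e.symm j))⁻¹ * μ (e.symm j)) =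
        s.x.repr (A v) := by
      ext1 j
      rw [mul_assoc, inv_mul_cancel₀ (hμ0 _), mul_one, Equiv.apply_symm_apply]
    rw [this, sub_add_cancel]

end SVD

namespace FilteredComplex.IsFloerType

variable {C : FilteredComplex.{u, v} K Γ}

theorem normed_cycles (hC : C.IsFloerType) (k : ℤ) :
    IsNonArchNormed K Γ (fun z : C.cycles k => C.ℓ k z) :=
  (hC.orthogonalizable k).1.comp_injective (C.cycles k).subtype Subtype.val_injective

theorem bars_eq (hC : C.IsFloerType) (k : ℤ) (s : C.BoundarySVD k) :
    s.bars = C.verboseBarcode k := by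
  rw [verboseBarcode, dif_pos ⟨s⟩]
  exact SVD.bars_unique (hC.orthogonalizable (k + 1)).1 (hC.normed_cycles k) (hC.bd_le k) _ _

/-- Bases of cycles, and of complements of cycles, with prescribed filtration levels. -/
theorem exists_normal_form (hC : C.IsFloerType) (k : ℤ) {n : ℕ} (a : Fin n → ℝ)
    (L : Fin n → ℝ≥0∞)
    (h : Finset.univ.val.map (fun i => ((a i : ℝ ⧸ Γ), L i)) = C.verboseBarcode k) :
    ∃ x : Fin n → C.toComplex.X k,
      (∀ i, C.bd k (k - 1) (x i) = 0) ∧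
      (∀ c : Fin n → Novikov K Γ, C.ℓ k (∑ i, c i • x i) =
        Finset.univ.sup fun i => (a i : EReal) - nu (c i)) ∧
      (∀ z, C.bd k (k - 1) z = 0 → ∃ c : Fin n → Novikov K Γ, z = ∑ i, c i • x i) ∧
      ∀ m, m = k + 1 → ∃ y : Fin n → C.toComplex.X m,
        (∀ i, L i = ⊤ → y i = 0) ∧ (∀ i, L i ≠ ⊤ → C.bd m k (y i) = x i) ∧
        (∀ z, C.bd m k z = 0 → ∀ c : Fin n → Novikov K Γ, (∀ i, L i = ⊤ → c i = 0) →
          C.ℓ m (z + ∑ i, c i • y i) =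
            max (C.ℓ m z) (Finset.univ.sup fun i => ((a i : EReal) + (L i : EReal)) - nu (c i))) ∧
        ∀ v, ∃ (z : C.toComplex.X m) (c : Fin n → Novikov K Γ),
          C.bd m k z = 0 ∧ v = z + ∑ i, c i • y i := by
  obtain ⟨s⟩ := hC.nonempty_boundarySVD k
  obtain ⟨x, y, h1, h2, h3, h4, h5, h6⟩ := s.exists_rescaling (hC.orthogonalizable (k + 1)).1
    (hC.normed_cycles k) (hC.bd_le k) a L (h.trans (hC.bars_eq k s).symm)
  have hker : ∀ z, C.bdToCycles k z = 0 ↔ C.bd (k + 1) k z = 0 := fun z => Subtype.ext_iff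
  have hsum := coe_sum_smul (C.cycles k) x
  refine ⟨fun i => x i, fun i => (x i).2, fun c => ?_, fun z hz => ?_, ?_⟩
  · rw [← h1 c, hsum]
  · obtain ⟨c, hc⟩ := h2 ⟨z, hz⟩
    exact ⟨c, by rw [← hsum, ← hc]⟩
  -- Keeping $m$ as a variable lets the result be used with $k=m-1$ without identifying degrees
  -- $m-1+1$ and $m$ by a cast.
  · rintro m rfl
    refine ⟨y, h3, fun i hi => congrArg Subtype.val (h4 i hi), fun z hz => h5 z ((hker z).mpr hz),
      fun v => ?_⟩
    obtain ⟨z, c, hz, hv⟩ := h6 v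
    exact ⟨z, c, (hker z).mp hz, hv⟩

end FilteredComplex.IsFloerType

end Normalization

end FloerNovikov
namespace FloerNovikov

universe z

/-- Unlike `LinearMap.ker_eq_bot`, this needs no subtraction on the source. -/
theorem injective_of_eq_zero {R M N : Type*} [Ring R] [AddCommMonoid M] [Module R M]
    [AddCommGroup N] [Module R N] (f : M →ₗ[R] N) (h : ∀ d, f d = 0 → d = 0) :
    Function.Injective f := by
  intro d d' hdd
  have he : d + (-1 : R) • d' = 0 := h _ (by
    rw [map_add, map_smul, hdd, neg_one_smul, add_neg_cancel])
  calc d = d + ((-1 : R) + 1) • d' := by rw [neg_add_cancel, zero_smul, add_zero]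
    _ = (d + (-1 : R) • d') + d' := by rw [add_smul, one_smul, add_assoc]
    _ = d' := by rw [he, zero_add]

/-! ### Direct sums of elementary complexes and the normal form -/

section NormalForm

variable {K : Type u} [Field K] {Γ : AddSubgroup ℝ}

namespace ElementarySum

variable {n : ℤ → ℕ} (L : ∀ k, Fin (n k) → ℝ≥0∞)

variable (K Γ) in
/-- The degree-`m` part of a direct sum of elementary complexes. -/
abbrev Space (m : ℤ) : Type u :=
  ⨁ p : (Σ k : ℤ, Fin (n k)), elementaryX K Γ (L p.1 p.2) p.1 m

/-- A shortcut for instance search. -/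
noncomputable abbrev moduleElementaryX (b : ℝ≥0∞) (k m : ℤ) : Module (Novikov K Γ) (elementaryX K Γ b k m) :=
  (elementaryX K Γ b k m).module

attribute [local instance] moduleElementaryX

/-- A shortcut for instance search. -/
noncomputable abbrev moduleSpace (m : ℤ) : Module (Novikov K Γ) (Space K Γ L m) :=
  DirectSum.instModule

attribute [local instance] moduleSpace

variable (K Γ) in
/-- The coefficient of the lower generator of a summand. -/
noncomputable def lower (m : ℤ) (p : Σ k : ℤ, Fin (n k)) :
    Space K Γ L m →ₗ[Novikov K Γ] Novikov K Γ :=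
  LinearMap.fst _ _ _ ∘ₗ (elementaryX K Γ (L p.1 p.2) p.1 m).subtype ∘ₗ
    DirectSum.component (Novikov K Γ) _ _ p

variable (K Γ) in
/-- The coefficient of the upper generator of a summand. -/
noncomputable def upper (m : ℤ) (p : Σ k : ℤ, Fin (n k)) :
    Space K Γ L m →ₗ[Novikov K Γ] Novikov K Γ :=
  LinearMap.snd _ _ _ ∘ₗ (elementaryX K Γ (L p.1 p.2) p.1 m).subtype ∘ₗ
    DirectSum.component (Novikov K Γ) _ _ p

variable {L}

theorem lower_apply {m : ℤ} (p : Σ k : ℤ, Fin (n k)) (d : Space K Γ L m) :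
    lower K Γ L m p d = (d p).1.1 := rfl

theorem upper_apply {m : ℤ} (p : Σ k : ℤ, Fin (n k)) (d : Space K Γ L m) :
    upper K Γ L m p d = (d p).1.2 := rfl

theorem lower_eq_zero {m : ℤ} {p : Σ k : ℤ, Fin (n k)} (h : m ≠ p.1) (d : Space K Γ L m) :
    lower K Γ L m p d = 0 := (d p).2.1 h

theorem upper_eq_zero {m : ℤ} {p : Σ k : ℤ, Fin (n k)} (h : ¬ (m = p.1 + 1 ∧ L p.1 p.2 ≠ ⊤))
    (d : Space K Γ L m) : upper K Γ L m p d = 0 := (d p).2.2 h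

theorem ext_coeff {m : ℤ} {d d' : Space K Γ L m} (h1 : ∀ p, lower K Γ L m p d = lower K Γ L m p d')
    (h2 : ∀ p, upper K Γ L m p d = upper K Γ L m p d') : d = d' :=
  DFinsupp.ext fun p => Subtype.ext (Prod.ext (h1 p) (h2 p))

theorem exists_lower (m : ℤ) (i : Fin (n m)) : ∃ d : Space K Γ L m,
    lower K Γ L m ⟨m, i⟩ d = 1 ∧ (∀ p, p ≠ ⟨m, i⟩ → lower K Γ L m p d = 0) ∧
      ∀ p, upper K Γ L m p d = 0 := by
  classical
  refine ⟨DirectSum.of (fun p : Σ k : ℤ, Fin (n k) => elementaryX K Γ (L p.1 p.2) p.1 m) ⟨m, i⟩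
    ⟨(1, 0), fun h => absurd rfl h, fun _ => rfl⟩, ?_, fun p hp => ?_, fun p => ?_⟩
  · rw [lower_apply, DirectSum.of_eq_same]
  · rw [lower_apply, DirectSum.of_eq_of_ne _ _ _ hp]; rfl
  · by_cases hp : p = ⟨m, i⟩
    · subst hp; rw [upper_apply, DirectSum.of_eq_same]
    · rw [upper_apply, DirectSum.of_eq_of_ne _ _ _ hp]; rfl

theorem exists_upper {m k : ℤ} (hm : m = k + 1) (i : Fin (n k)) (hL : L k i ≠ ⊤) :
    ∃ d : Space K Γ L m,
      upper K Γ L m ⟨k, i⟩ d = 1 ∧ (∀ p, p ≠ ⟨k, i⟩ → upper K Γ L m p d = 0) ∧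
      ∀ p, lower K Γ L m p d = 0 := by
  classical
  refine ⟨DirectSum.of (fun p : Σ k : ℤ, Fin (n k) => elementaryX K Γ (L p.1 p.2) p.1 m) ⟨k, i⟩
    ⟨(0, 1), fun _ => rfl, fun h => absurd ⟨hm, hL⟩ h⟩, ?_, fun p hp => ?_, fun p => ?_⟩
  · rw [upper_apply, DirectSum.of_eq_same]
  · rw [upper_apply, DirectSum.of_eq_of_ne _ _ _ hp]; rfl
  · by_cases hp : p = ⟨k, i⟩
    · subst hp; rw [lower_apply, DirectSum.of_eq_same]
    · rw [lower_apply, DirectSum.of_eq_of_ne _ _ _ hp]; rfl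

section Map

variable {M : Type v} [AddCommGroup M] [Module (Novikov K Γ) M]

variable (K Γ L) in
/-- The linear map with prescribed images of the generators. -/
noncomputable def toModule (m k : ℤ) (x : Fin (n m) → M) (y : Fin (n k) → M) :
    Space K Γ L m →ₗ[Novikov K Γ] M :=
  ∑ i, (lower K Γ L m ⟨m, i⟩).smulRight (x i) + ∑ i, (upper K Γ L m ⟨k, i⟩).smulRight (y i)

theorem toModule_apply (m k : ℤ) (x : Fin (n m) → M) (y : Fin (n k) → M) (d : Space K Γ L m) :
    toModule K Γ L m k x y d =
      ∑ i, lower K Γ L m ⟨m, i⟩ d • x i + ∑ i, upper K Γ L m ⟨k, i⟩ d • y i := by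
  simp [toModule]

theorem mem_range_lower (m k : ℤ) (x : Fin (n m) → M) (y : Fin (n k) → M) (i : Fin (n m)) :
    x i ∈ LinearMap.range (toModule K Γ L m k x y) := by
  obtain ⟨d, h1, h2, h3⟩ := exists_lower (K := K) (Γ := Γ) (L := L) m i
  refine ⟨d, ?_⟩
  rw [toModule_apply, Finset.sum_eq_single i, h1, one_smul, Finset.sum_eq_zero, add_zero]
  · exact fun j _ => by rw [h3, zero_smul]
  · intro j _ hj
    rw [h2 _ fun h => hj (by simpa using h), zero_smul]
  · exact fun h => absurd (Finset.mem_univ i) h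

theorem mem_range_upper {m k : ℤ} (hm : m = k + 1) (x : Fin (n m) → M) (y : Fin (n k) → M)
    (i : Fin (n k)) (hy : L k i = ⊤ → y i = 0) :
    y i ∈ LinearMap.range (toModule K Γ L m k x y) := by
  by_cases hL : L k i = ⊤
  · rw [hy hL]; exact Submodule.zero_mem _
  obtain ⟨d, h1, h2, h3⟩ := exists_upper (K := K) (Γ := Γ) hm i hL
  refine ⟨d, ?_⟩
  rw [toModule_apply, Finset.sum_eq_zero, zero_add, Finset.sum_eq_single i, h1, one_smul]
  · intro j _ hj
    rw [h2 _ fun h => hj (by simpa using h), zero_smul]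
  · exact fun h => absurd (Finset.mem_univ i) h
  · exact fun j _ => by rw [h3, zero_smul]

end Map

/-- The filtration function of a direct sum of elementary complexes in terms of coefficients. -/
theorem iSup_eq (a : ∀ k, Fin (n k) → ℝ) {m k : ℤ} (hm : m = k + 1) (d : Space K Γ L m) :
    (⨆ p : Σ k : ℤ, Fin (n k), max ((a p.1 p.2 : EReal) - nu (lower K Γ L m p d))
      (((a p.1 p.2 : EReal) + (L p.1 p.2 : EReal)) - nu (upper K Γ L m p d))) =
    max (Finset.univ.sup fun i => (a m i : EReal) - nu (lower K Γ L m ⟨m, i⟩ d))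
      (Finset.univ.sup fun i =>
        ((a k i : EReal) + (L k i : EReal)) - nu (upper K Γ L m ⟨k, i⟩ d)) := by
  apply le_antisymm
  · refine iSup_le ?_
    rintro ⟨l, i⟩
    apply max_le_max
    · by_cases hl : m = l
      · subst hl
        exact Finset.le_sup (f := fun i => (a m i : EReal) - nu (lower K Γ L m ⟨m, i⟩ d))
          (Finset.mem_univ i)
      · rw [lower_eq_zero hl, nu_zero]; simp
    · by_cases hl : k = l
      · subst hl
        exact Finset.le_sup (f := fun i =>
          ((a k i : EReal) + (L k i : EReal)) - nu (upper K Γ L m ⟨k, i⟩ d)) (Finset.mem_univ i)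
      · rw [upper_eq_zero fun h => hl (by have := h.1; simp only at this; omega), nu_zero]; simp
  · refine max_le (Finset.sup_le fun i _ => ?_) (Finset.sup_le fun i _ => ?_)
    · exact le_iSup_of_le ⟨m, i⟩ (le_max_left _ _)
    · exact le_iSup_of_le ⟨k, i⟩ (le_max_right _ _)

theorem coe_sub_nu_eq_bot {b : ℝ} {c : Novikov K Γ} (h : (b : EReal) - nu c = ⊥) : c = 0 := by
  by_contra hc
  rw [nu_of_ne_zero hc, ← EReal.coe_sub] at h
  exact EReal.coe_ne_bot _ h

theorem eq_zero_of_iSup_eq_bot (a : ∀ k, Fin (n k) → ℝ) {m : ℤ} (d : Space K Γ L m)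
    (h : (⨆ p : Σ k : ℤ, Fin (n k), max ((a p.1 p.2 : EReal) - nu (lower K Γ L m p d))
      (((a p.1 p.2 : EReal) + (L p.1 p.2 : EReal)) - nu (upper K Γ L m p d))) = ⊥) : d = 0 := by
  have h1 := fun p => max_eq_bot.mp (iSup_eq_bot.mp h p)
  refine ext_coeff (fun p => ?_) (fun p => ?_)
  · rw [map_zero]; exact coe_sub_nu_eq_bot (h1 p).1
  · rw [map_zero]
    by_cases hL : L p.1 p.2 = ⊤
    · exact upper_eq_zero (fun h => h.2 hL) d
    · have h2 := (h1 p).2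
      rw [← EReal.coe_ennreal_toReal hL, ← EReal.coe_add] at h2
      exact coe_sub_nu_eq_bot h2

end ElementarySum

attribute [local instance] ElementarySum.moduleElementaryX ElementarySum.moduleSpace

namespace FilteredComplex

/-- The inverse of a filtered chain isomorphism. -/
noncomputable def FilteredIso.symm {C : FilteredComplex.{u, v} K Γ}
    {D : FilteredComplex.{u, w} K Γ} (Φ : FilteredIso C D) : FilteredIso D C where
  toEquiv k := (Φ.toEquiv k).symm
  comm i j x := by
    rw [LinearEquiv.symm_apply_eq, Φ.comm, LinearEquiv.apply_symm_apply]
  map_ℓ k x := by rw [← Φ.map_ℓ, LinearEquiv.apply_symm_apply]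

/-- The composition of filtered chain isomorphisms. -/
noncomputable def FilteredIso.trans {C : FilteredComplex.{u, v} K Γ}
    {D : FilteredComplex.{u, z} K Γ} {E : FilteredComplex.{u, w} K Γ}
    (Φ : FilteredIso C D) (Ψ : FilteredIso D E) : FilteredIso C E where
  toEquiv k := (Φ.toEquiv k).trans (Ψ.toEquiv k)
  comm i j x := by simp only [LinearEquiv.trans_apply, Φ.comm, Ψ.comm]
  map_ℓ k x := by simp only [LinearEquiv.trans_apply, Φ.map_ℓ, Ψ.map_ℓ]

open ElementarySum in
theorem IsFloerType.nonempty_normalForm {C : FilteredComplex.{u, v} K Γ} (hC : C.IsFloerType)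
    (n : ℤ → ℕ) (a : ∀ k, Fin (n k) → ℝ) (L : ∀ k, Fin (n k) → ℝ≥0∞)
    (h : ∀ k, (Finset.univ : Finset (Fin (n k))).val.map
      (fun i => ((a k i : ℝ ⧸ Γ), L k i)) = C.verboseBarcode k) :
    Nonempty (FilteredIso C
      (directSum fun p : Σ k : ℤ, Fin (n k) => elementary K Γ (a p.1 p.2) (L p.1 p.2) p.1)) := by
  set D := directSum fun p : Σ k : ℤ, Fin (n k) => elementary K Γ (a p.1 p.2) (L p.1 p.2) p.1
    with hD
  choose x hx0 hxℓ hxs hy using fun k => hC.exists_normal_form k (a k) (L k) (h k)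
  choose y hy0 hyx hyℓ hys using fun m => hy (m - 1) m (by omega)
  -- Infinite bars cause no trouble: their $y$ is $0$ and the summand has no upper generator.
  let Ψ : ∀ m, Space K Γ L m →ₗ[Novikov K Γ] C.toComplex.X m := fun m =>
    toModule K Γ L m (m - 1) (x m) (y m)
  have hbdx : ∀ m (c : Fin (n m) → Novikov K Γ), C.bd m (m - 1) (∑ i, c i • x m i) = 0 := by
    intro m c
    rw [map_sum]
    exact Finset.sum_eq_zero fun i _ => by rw [map_smul, hx0, smul_zero]
  have hℓ : ∀ m (d : Space K Γ L m), C.ℓ m (Ψ m d) =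
      ⨆ p : Σ k : ℤ, Fin (n k), max ((a p.1 p.2 : EReal) - nu (lower K Γ L m p d))
      (((a p.1 p.2 : EReal) + (L p.1 p.2 : EReal)) - nu (upper K Γ L m p d)) := by
    intro m d
    rw [iSup_eq a (by omega : m = m - 1 + 1), toModule_apply,
      hyℓ m _ (hbdx m _) _ fun i hi => upper_eq_zero (fun h => h.2 hi) d, hxℓ]
  have hinj : ∀ m, Function.Injective (Ψ m) := by
    intro m
    -- A kernel element has level $-\infty$ because $\Psi$ preserves levels, hence is zero.
    refine injective_of_eq_zero (Ψ m) fun d hd => eq_zero_of_iSup_eq_bot a d ?_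
    rw [← hℓ, hd]
    exact (hC.orthogonalizable m).1.map_zero
  have hsurj : ∀ m, Function.Surjective (Ψ m) := by
    intro m
    rw [← LinearMap.range_eq_top, eq_top_iff]
    rintro v -
    obtain ⟨z, c, hz, rfl⟩ := hys m v
    obtain ⟨b, rfl⟩ := hxs m z hz
    exact Submodule.add_mem _
      (Submodule.sum_mem _ fun i _ => Submodule.smul_mem _ _ (mem_range_lower _ _ _ _ i))
      (Submodule.sum_mem _ fun i _ => Submodule.smul_mem _ _
        (mem_range_upper (by omega) _ _ i (hy0 m i)))
  have hcomm : ∀ i j (d : D.toComplex.X i), Ψ j (D.bd i j d) = C.bd i j (Ψ i d) := by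
    intro i j d
    by_cases hij : (ComplexShape.down ℤ).Rel i j
    swap
    · rw [bd_eq_zero D hij, bd_eq_zero C hij]; exact map_zero _
    obtain rfl : j = i - 1 := by
      have : j + 1 = i := hij
      omega
    have hlow : ∀ p, lower K Γ L (i - 1) p (D.bd i (i - 1) d) = upper K Γ L i p d := fun p => by
      have h1 : (elementaryBd K Γ (L p.1 p.2) p.1 i (i - 1)
          (DFunLike.coe (F := Space K Γ L i) d p)).1.1 =
          (DFunLike.coe (F := Space K Γ L i) d p).1.2 := by
        rw [elementaryBd, dif_pos (by omega)]; rfl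
      exact h1
    have hup : ∀ p, upper K Γ L (i - 1) p (D.bd i (i - 1) d) = 0 := fun p => by
      have h1 : (elementaryBd K Γ (L p.1 p.2) p.1 i (i - 1)
          (DFunLike.coe (F := Space K Γ L i) d p)).1.2 = 0 := by
        rw [elementaryBd, dif_pos (by omega)]; rfl
      exact h1
    have h2 := toModule_apply (i - 1) (i - 1 - 1) (x (i - 1)) (y (i - 1)) (D.bd i (i - 1) d)
    have h3 := toModule_apply i (i - 1) (x i) (y i) d
    refine h2.trans (Eq.trans ?_ (congrArg (C.bd i (i - 1)) h3).symm)
    -- The $x$-part is a cycle, so only upper coefficients survive; on the other side they reappear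
    -- as the lower coefficients one degree down.
    rw [map_add, hbdx, zero_add, map_sum]
    simp only [hlow, hup, zero_smul, Finset.sum_const_zero, add_zero, map_smul]
    refine Finset.sum_congr rfl fun q _ => ?_
    by_cases hL : L (i - 1) q = ⊤
    · have h4 : upper K Γ L i ⟨i - 1, q⟩ d = 0 := upper_eq_zero (fun h => h.2 hL) d
      rw [h4, zero_smul, zero_smul]
    · rw [hyx i q hL]
  let Φ : FilteredIso D C :=
    { toEquiv := fun m => LinearEquiv.ofBijective (Ψ m) ⟨hinj m, hsurj m⟩
      comm := hcomm
      map_ℓ := hℓ }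
  exact ⟨Φ.symm⟩

end FilteredComplex

end NormalForm

end FloerNovikov
namespace FloerNovikov

/-! ### Invariance of the barcode under filtered isomorphism -/

section Invariance

variable {K : Type u} [Field K] {Γ : AddSubgroup ℝ}

/-- Push both bases forward: the isometries intertwine the two maps, so they carry kernel to kernel
and image to image and leave all levels unchanged. -/
theorem SVD.exists_bars_eq_of_isometry
    {V : Type*} {W : Type*} [AddCommGroup V] [Module (Novikov K Γ) V]
    [AddCommGroup W] [Module (Novikov K Γ) W] {ℓV : V → EReal} {ℓW : W → EReal}
    {V' : Type*} {W' : Type*} [AddCommGroup V'] [Module (Novikov K Γ) V']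
    [AddCommGroup W'] [Module (Novikov K Γ) W'] {ℓV' : V' → EReal} {ℓW' : W' → EReal}
    {A : V →ₗ[Novikov K Γ] W} {A' : V' →ₗ[Novikov K Γ] W'} (s : SVD ℓV ℓW A)
    (φ : V ≃ₗ[Novikov K Γ] V') (ψ : W ≃ₗ[Novikov K Γ] W') (hA : ∀ v, ψ (A v) = A' (φ v))
    (hφ : ∀ v, ℓV' (φ v) = ℓV v) (hψ : ∀ w, ℓW' (ψ w) = ℓW w) :
    ∃ t : SVD ℓV' ℓW' A', t.bars = s.bars := by
  have hrange : (LinearMap.range A).map ψ.toLinearMap = LinearMap.range A' := by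
    ext w
    constructor
    · rintro ⟨_, ⟨v, rfl⟩, rfl⟩
      exact ⟨φ v, (hA v).symm⟩
    · rintro ⟨v, rfl⟩
      exact ⟨A (φ.symm v), ⟨_, rfl⟩, by simp [hA]⟩
  have hker : (LinearMap.ker A).map φ.toLinearMap = LinearMap.ker A' := by
    ext v
    constructor
    · rintro ⟨u, hu, rfl⟩
      have hu' : A u = 0 := hu
      change A' (φ u) = 0
      rw [← hA, hu', map_zero]
    · intro hv
      refine ⟨φ.symm v, ?_, by simp⟩
      change A (φ.symm v) = 0
      apply ψ.injective
      rw [hA, map_zero, LinearEquiv.apply_symm_apply]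
      exact hv
  have hr : Module.finrank (Novikov K Γ) (LinearMap.range A') =
      Module.finrank (Novikov K Γ) (LinearMap.range A) := by
    rw [← hrange]; exact LinearEquiv.finrank_map_eq ψ _
  have hy : ∀ i, s.y.map φ i = φ (s.y i) := fun i => Module.Basis.map_apply _ _ _
  have hx : ∀ i, s.x.map ψ i = ψ (s.x i) := fun i => Module.Basis.map_apply _ _ _
  refine ⟨⟨s.n, s.m, s.y.map φ, s.x.map ψ, ?_, ?_, ?_, ?_, ?_, ?_⟩, ?_⟩
  · intro c
    have := s.orthogonal_y c
    simp only [hy, ← map_smul, ← map_sum, hφ]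
    exact this
  · intro c
    have := s.orthogonal_x c
    simp only [hx, ← map_smul, ← map_sum, hψ]
    exact this
  · rw [hr, ← hker, ← s.span_ker, Submodule.map_span]
    congr 1
    ext v
    simp only [hy, Set.mem_image, Set.mem_ofPred_eq]
    constructor
    · rintro ⟨i, hi, rfl⟩; exact ⟨_, ⟨i, hi, rfl⟩, rfl⟩
    · rintro ⟨_, ⟨i, hi, rfl⟩, rfl⟩; exact ⟨i, hi, rfl⟩
  · refine Eq.trans ?_ (((Submodule.map_span _ _).symm.trans
      (congrArg (Submodule.map ψ.toLinearMap) s.span_range)).trans hrange)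
    rw [hr]
    congr 1
    ext v
    simp only [hx, Set.mem_image, Set.mem_ofPred_eq]
    constructor
    · rintro ⟨i, hi, rfl⟩; exact ⟨_, ⟨i, hi, rfl⟩, rfl⟩
    · rintro ⟨_, ⟨i, hi, rfl⟩, rfl⟩; exact ⟨i, hi, rfl⟩
  · intro i j hij hi
    rw [hy, hx, ← hA, s.map_eq i j hij (hr ▸ hi)]
  · intro i i' j j' hij hij' hle hi'
    simp only [hy, hx, hφ, hψ]
    exact s.sorted i i' j j' hij hij' hle (hr ▸ hi')
  · simp only [SVD.bars, hr, hy, hx, hφ, hψ]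

namespace FilteredComplex

theorem verboseBarcode_eq_of_iso {C : FilteredComplex.{u, v} K Γ} {D : FilteredComplex.{u, w} K Γ}
    (hC : C.IsFloerType) (hD : D.IsFloerType) (Φ : FilteredIso C D) (k : ℤ) :
    C.verboseBarcode k = D.verboseBarcode k := by
  obtain ⟨s⟩ := hC.nonempty_boundarySVD k
  have hmap : (C.cycles k).map (Φ.toEquiv k).toLinearMap = D.cycles k := by
    ext x
    constructor
    · rintro ⟨z, hz, rfl⟩
      have hz' : C.bd k (k - 1) z = 0 := hz
      change D.bd k (k - 1) (Φ.toEquiv k z) = 0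
      rw [← Φ.comm, hz', map_zero]
    · intro hx
      refine ⟨(Φ.toEquiv k).symm x, ?_, LinearEquiv.apply_symm_apply _ _⟩
      change C.bd k (k - 1) ((Φ.toEquiv k).symm x) = 0
      apply (Φ.toEquiv (k - 1)).injective
      rw [Φ.comm, LinearEquiv.apply_symm_apply, map_zero]
      exact hx
  obtain ⟨t, ht⟩ := s.exists_bars_eq_of_isometry (A' := D.bdToCycles k)
    (ℓV' := D.ℓ (k + 1)) (ℓW' := fun z : D.cycles k => D.ℓ k z) (Φ.toEquiv (k + 1))
    ((Φ.toEquiv k).ofSubmodules _ _ hmap) (fun v => Subtype.ext (Φ.comm _ _ v)) (Φ.map_ℓ _)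
    (fun z => Φ.map_ℓ k z)
  rw [← hC.bars_eq k s, ← ht, hD.bars_eq k t]

theorem exists_enumeration (C : FilteredComplex.{u, v} K Γ) :
    ∃ (n : ℤ → ℕ) (a : ∀ k, Fin (n k) → ℝ) (L : ∀ k, Fin (n k) → ℝ≥0∞),
      ∀ k, (Finset.univ : Finset (Fin (n k))).val.map
        (fun i => ((a k i : ℝ ⧸ Γ), L k i)) = C.verboseBarcode k := by
  have key : ∀ k, ∃ (n : ℕ) (a : Fin n → ℝ) (L : Fin n → ℝ≥0∞),
      (Finset.univ : Finset (Fin n)).val.map (fun i => ((a i : ℝ ⧸ Γ), L i)) =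
        C.verboseBarcode k := by
    intro k
    obtain ⟨l, hl⟩ := Quot.exists_rep (C.verboseBarcode k)
    choose a ha using fun i : Fin l.length => QuotientAddGroup.mk_surjective (l.get i).1
    refine ⟨l.length, a, fun i => (l.get i).2, ?_⟩
    have h1 : (fun i => ((a i : ℝ ⧸ Γ), (l.get i).2)) = l.get := by
      ext1 i; exact Prod.ext (ha i) rfl
    rw [h1, Fin.univ_val_map, List.ofFn_get]
    exact hl
  choose n a L h using key
  exact ⟨n, a, L, h⟩

end FilteredComplex

end Invariance

end FloerNovikov

open FloerNovikov FilteredComplex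
theorem theoremA {K : Type u} [Field K] (Γ : AddSubgroup ℝ) :
    -- Well-definedness of the barcode: singular value decompositions exist, and all of them give
    -- the same verbose barcode.
    (∀ C : FilteredComplex.{u, v} K Γ, C.IsFloerType → ∀ k : ℤ,
      Nonempty (C.BoundarySVD k) ∧ ∀ s : C.BoundarySVD k, s.bars = C.verboseBarcode k) ∧
    -- The classification.
    (∀ (C : FilteredComplex.{u, v} K Γ) (D : FilteredComplex.{u, w} K Γ),
      C.IsFloerType → D.IsFloerType →
        (Nonempty (FilteredIso C D) ↔ ∀ k : ℤ, C.verboseBarcode k = D.verboseBarcode k)) ∧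
    -- The normal form, for any enumeration of the barcodes and any representatives of the cosets.
    (∀ C : FilteredComplex.{u, v} K Γ, C.IsFloerType →
      ∀ (n : ℤ → ℕ) (a : ∀ k, Fin (n k) → ℝ) (L : ∀ k, Fin (n k) → ℝ≥0∞),
        (∀ k, (Finset.univ : Finset (Fin (n k))).val.map
          (fun i => ((a k i : ℝ ⧸ Γ), L k i)) = C.verboseBarcode k) →
        Nonempty (FilteredIso C
          (directSum fun p : Σ k : ℤ, Fin (n k) => elementary K Γ (a p.1 p.2) (L p.1 p.2) p.1))) :=
  by
  refine ⟨fun C hC k => ⟨hC.nonempty_boundarySVD k, hC.bars_eq k⟩, fun C D hC hD => ⟨?_, ?_⟩,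
    fun C hC n a L h => hC.nonempty_normalForm n a L h⟩
  · rintro ⟨Φ⟩ k
    exact verboseBarcode_eq_of_iso hC hD Φ k
  · intro h
    obtain ⟨n, a, L, hn⟩ := C.exists_enumeration
    obtain ⟨Φ⟩ := hC.nonempty_normalForm n a L hn
    -- Using for $D$ the enumeration and representatives chosen for $C$ makes the two normal forms
    -- literally the same complex.
    obtain ⟨Ψ⟩ := hD.nonempty_normalForm n a L fun k => (hn k).trans (h k)
    exact ⟨Φ.trans Ψ.symm⟩
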